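/- **Setting.** Let $H=\sum_{l=1}^{L}H_l$, $H_l=\alpha_lP_l$, be a Hamiltonian on $n$ qubits with $L\ge 1$, $\alpha_l>0$ and each $P_l$ a Pauli operator up to a sign; $\lambda=\sum_l\alpha_l$, $p_l=\alpha_l/\lambda$, $U(t)=e^{-iHt}$. Norms of operators are spectral norms. A $(\mu,\varepsilon)$-LCU formula of an operator $V$ is a finite sum $\tilde V=\sum_i c_iV_i$ with $c_i>0$, $V_i$ unitary, $\sum_ic_i=\mu$ and $\|V-\tilde V\|\le\varepsilon$. $W_0$ is the principal branch of the Lambert function. Let $K=0$, $K=1$ or $K=2k$ with $k\ge 1$. The Trotter formulas are $S_0(x)=I$, $S_1(x)=e^{-ixH_L}\cdots e^{-ixH_1}$, $S_2(x)=S_1(-x/2)^\dagger S_1(x/2)$ and $S_{2k}(x)=S_{2k-2}(u_kx)^2\,S_{2k-2}((1-4u_k)x)\,S_{2k-2}(u_kx)^2$ with $u_k=1/(4-4^{1/(2k-1)})$ for $k\ge2$. So $S_K(x)$ is a product of $\kappa_KL$ factors $e^{-ix\tau_jH_{l_j}}$, where $\kappa_0=0$, $\kappa_1=1$, $\kappa_{2k}=2\cdot5^{k-1}$.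 The sum of $|\tau_j|$ over the factors with $l_j=l$ does not depend on $l$; it is $\rho_0=0$, $\rho_1=\rho_2=1$, $\rho_{2k}=\prod_{i=2}^{k}(4|u_i|+|1-4u_i|)$. Put $\Lambda_K=(1+\rho_K)\lambda$; thus $\Lambda_0=\lambda$ and $\Lambda_1=\Lambda_2=2\lambda$. **Paired formula.** Expand $U(x)$ and each factor of $S_K(x)^\dagger$ in the Trotter remainder $U(x)S_K(x)^\dagger$ in its Taylor series. The part of order $s$ in $x$ is $\eta_s\sum_\gamma\Pr(\gamma|s)P(\gamma)$, with $\eta_s=(\Lambda_Kx)^s/s!$, where $\gamma$ consists of the power $r$ from $U(x)$, the powers $m_j$ from the factors of $S_K(x)^\dagger$, $r+\sum_jm_j=s$, and $l_1,\dots,l_r$; $\Pr(\gamma|s)$ is the multinomial probability of $(r,(m_j))$ with parameters $\lambda/\Lambda_K$ and $\alpha_{l_j}|\tau_j|/\Lambda_K$, times $p_{l_1}\cdots p_{l_r}$; and $P(\gamma)=(-i)^rP_{l_1}\cdots P_{l_r}\prod_j(i\,\mathrm{sgn}(\tau_j)P_{l_j})^{m_j}$, the factors in the order of $S_K(x)^\dagger$.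 Let $\eta_\Sigma=\sum_{s=K+1}^{2K+1}\eta_s$, $\theta=\arctan\eta_\Sigma$, and let $P'(\gamma)$ be $-iP(\gamma)$ if $P(\gamma)$ is anti-Hermitian and $P(\gamma)$ otherwise. For $s_c\ge 2K+1$ put $\tilde U_K(x)=\tilde V_K(x)S_K(x)$ with $$\tilde V_K(x)=\sqrt{1+\eta_\Sigma^2}\sum_{s=K+1}^{2K+1}\frac{\eta_s}{\eta_\Sigma}\sum_\gamma\Pr(\gamma|s)\,e^{i\theta P'(\gamma)}+\sum_{s=2K+2}^{s_c}\eta_s\sum_\gamma\Pr(\gamma|s)P(\gamma),$$ whose 1-norm is $\mu_K(x)=\sqrt{1+\eta_\Sigma^2}+\sum_{s=2K+2}^{s_c}\eta_s$. **Theorem.** Let $C_0=\tfrac32$, $C_1=e+\tfrac29$, $C_{2k}=e+\tfrac12\left(\tfrac{e}{2k+1}\right)^{4k+2}$ and, for $t>0$ and $\mu>1$, $\nu_K(t)=\left(\frac{C_K\Lambda_Kt}{\ln\mu}\right)^{\frac1{2K+1}}\Lambda_Kt$. (1) Let $t>0$, $\mu>1$, $0<\varepsilon<1$, and let the integers $\nu,s_c$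 satisfy $\nu\ge\nu_0(t)$ if $K=0$, $\nu\ge\max\{\nu_K(t),\Lambda_Kt\}$ if $K\ge1$, and $$s_c\ge\max\left\{\left\lceil\frac{\ln\left(\frac\mu\varepsilon\nu_K(t)\right)}{W_0\left(\frac{\nu_K(t)}{e\Lambda_Kt}\ln\left(\frac\mu\varepsilon\nu_K(t)\right)\right)}-1\right\rceil,\;2,\;2K+1\right\}.$$ Then $\tilde U_K(t/\nu)^\nu$, written out as a linear combination of products of the unitaries above, is an LCU formula of $U(t)$ with error at most $\varepsilon$ and 1-norm $\mu_K(t/\nu)^\nu\le\mu$. Moreover, for any two samples $i,j$ of its elementary unitaries $W_i,W_j$, the random-sampling circuit, which applies in each segment the Trotter circuit without control, then the sampled compensation of $i$ controlled on the ancilla state $|1\rangle$ and that of $j$ controlled on $|0\rangle$, consists of Pauli gates, Pauli rotations and their controlled versions, and realizes $|0\rangle\langle0|\otimes W_j+|1\rangle\langle1|\otimes W_i$. (2) For the smallest such $\nu$ and $s_c$, the number of gates (Pauli gates, Pauli rotations and controlled versions of them) of every sampled circuit is $$\mathcal O\left((\lambda t)^{1+\frac1{2K+1}}\left(\kappa_KL+\frac{\log(1/\varepsilon)}{\log\log(1/\varepsilon)}\right)\right),$$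 with an implied constant that depends only on $K$ and $\mu$, for all $n$, $L$, $H$, $t$, $\varepsilon$ with $\lambda t\ge1$ and $0<\varepsilon<1/e$. -/

import Mathlib

open scoped Matrix Kronecker Matrix.Norms.L2Operator

noncomputable section

namespace PTS

/-! ### Pauli operators and Pauli-decomposed Hamiltonians -/

/-- Computational basis labels of `n` qubits. -/
abbrev Basis (n : ℕ) : Type := Fin n → Fin 2

/-- Operators on `n` qubits.  The norm in force is the spectral (`ℓ²` operator) norm. -/
abbrev Op (n : ℕ) : Type := Matrix (Basis n) (Basis n) ℂ

inductive Pauli : Type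
  | I | X | Y | Z

/-- The single-qubit Pauli matrices. -/
def Pauli.mat : Pauli → Matrix (Fin 2) (Fin 2) ℂ
  | .I => !![1, 0; 0, 1]
  | .X => !![0, 1; 1, 0]
  | .Y => !![0, -Complex.I; Complex.I, 0]
  | .Z => !![1, 0; 0, -1]

/-- The `n`-qubit Pauli operator `σ₁ ⊗ ⋯ ⊗ σₙ`. -/
def pauliOp {n : ℕ} (σ : Fin n → Pauli) : Op n :=
  Matrix.of fun a b => ∏ q, (σ q).mat (a q) (b q)

/-- The data of `H = ∑ₗ αₗ Pₗ` with `αₗ > 0` and `Pₗ` a Pauli operator up to a sign. -/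
structure Hamiltonian (n L : ℕ) where
  coeff : Fin L → ℝ
  coeff_pos : ∀ l, 0 < coeff l
  sgn : Fin L → ℤˣ
  str : Fin L → Fin n → Pauli

/-! ### Trotter formulas as lists of stages

A stage `(l, τ)` stands for the factor `exp (-i x τ H_l)`.  Lists are in the order of the operator
product: the head of the list is the leftmost factor. -/

/-- The step size `u_k = 1 / (4 - 4^{1/(2k-1)})` of Suzuki's recursion. -/
def suzukiU (k : ℕ) : ℝ := 1 / (4 - (4 : ℝ) ^ (1 / (2 * (k : ℝ) - 1)))

/-- The stages of a Trotter formula run for time `c * x` instead of `x`. -/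
def scaleStages {L : ℕ} (c : ℝ) (st : List (Fin L × ℝ)) : List (Fin L × ℝ) :=
  st.map fun p => (p.1, c * p.2)

/-- Stages of the `2k`-th order formula:
`S_2(x) = (e^{-ixH_1/2} ⋯ e^{-ixH_L/2}) (e^{-ixH_L/2} ⋯ e^{-ixH_1/2})` and
`S_{2k}(x) = S_{2k-2}(u_k x)^2 S_{2k-2}((1-4u_k)x) S_{2k-2}(u_k x)^2`. -/
def suzukiStages (L : ℕ) : ℕ → List (Fin L × ℝ)
  | 0 => []
  | 1 => (List.finRange L).map (fun l => (l, 1 / 2)) ++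
      (List.finRange L).reverse.map (fun l => (l, 1 / 2))
  | k + 2 =>
      let A := scaleStages (suzukiU (k + 2)) (suzukiStages L (k + 1))
      let B := scaleStages (1 - 4 * suzukiU (k + 2)) (suzukiStages L (k + 1))
      A ++ A ++ B ++ A ++ A

/-- Stages of the `K`-th order formula, for `K = 0` (`S_0 = I`), `K = 1`
(`S_1(x) = e^{-ixH_L} ⋯ e^{-ixH_1}`) and `K = 2k`. -/
def trotterStages (L K : ℕ) : List (Fin L × ℝ) :=
  if K = 1 then (List.finRange L).reverse.map (fun l => (l, 1)) else suzukiStages L (K / 2)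

/-- The total length `∑ |τ|` of the stages that act with one given `H_l`, for order `2k`. -/
def suzukiLength : ℕ → ℝ
  | 0 => 0
  | 1 => 1
  | k + 2 => (4 * |suzukiU (k + 2)| + |1 - 4 * suzukiU (k + 2)|) * suzukiLength (k + 1)

/-- The total length `∑ |τ|` of the stages that act with one given `H_l`, for order `K`. It is
`0` for `K = 0` and `1` for `K = 1, 2`. -/
def trotterLength (K : ℕ) : ℝ := if K = 1 then 1 else suzukiLength (K / 2)

/-- The number of stages per summand `H_l`. -/
def kappa (K : ℕ) : ℕ := if K ≤ 1 then K else 2 * 5 ^ (K / 2 - 1)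

namespace Hamiltonian

variable {n L : ℕ} (H : Hamiltonian n L)

/-- `P_l`, with its sign. -/
def P (l : Fin L) : Op n := ((H.sgn l : ℤ) : ℂ) • pauliOp (H.str l)

/-- The operator `H = ∑ αₗ Pₗ`. -/
def op : Op n := ∑ l, (H.coeff l : ℂ) • H.P l

/-- `λ = ∑ αₗ`. -/
def lam : ℝ := ∑ l, H.coeff l

/-- `U(t) = e^{-iHt}`. -/
def U (t : ℝ) : Op n := NormedSpace.exp ((-(Complex.I * (t : ℂ))) • H.op)

/-- The gates `exp (-i x τ H_l)` of the Trotter circuit. -/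
def trotterGates (K : ℕ) (x : ℝ) : List (Op n) :=
  (trotterStages L K).map fun p =>
    NormedSpace.exp ((-(Complex.I * ((x * p.2 * H.coeff p.1 : ℝ) : ℂ))) • H.P p.1)

/-- The Trotter formula `S_K(x)`. -/
def S (K : ℕ) (x : ℝ) : Op n := (H.trotterGates K x).prod

/-- `Λ_K = λ + ∑ |τ| α_l`, summed over all stages: the 1-norm per unit of time of the exponents in
the Trotter remainder `U(x) S_K(x)†`. It is `λ` for `K = 0` and `2λ` for `K = 1, 2`. -/
def rate (K : ℕ) : ℝ := (1 + trotterLength K) * H.lam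

/-! ### Taylor expansion of the Trotter remainder `V_K(x) = U(x) S_K(x)†` -/

end Hamiltonian

/-- The stages of `S_K(x)†`, in the order of the operator product. -/
def remStages (L K : ℕ) : List (Fin L × ℝ) := (trotterStages L K).reverse

/-- Labels of the terms of order `s` in the expansion of all exponentials in `V_K(x)`: the powers
`r = m none` for `U(x)` and `m (some j)` for the `j`-th stage, with sum `s`, and the indices
`l_1, …, l_r` of the Pauli operators chosen in `H^r`. -/
abbrev TermIdx (L K s : ℕ) : Type :=
  Σ m : ↥(Finset.piAntidiag (Finset.univ : Finset (Option (Fin (remStages L K).length))) s),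
    Fin (m.1 none) → Fin L

/-- Labels of the elementary unitaries of one segment: an order `K < s ≤ s_c` and a term of that
order. -/
abbrev SegIdx (L K sc : ℕ) : Type := Σ s : ↥(Finset.Icc (K + 1) sc), TermIdx L K s.1

namespace Hamiltonian

variable {n L : ℕ} (H : Hamiltonian n L)

/-- `η_s = (Λ_K x)^s / s!`. -/
def eta (K : ℕ) (x : ℝ) (s : ℕ) : ℝ := (H.rate K * x) ^ s / (s.factorial : ℝ)

/-- `η_Σ`, the sum of `η_s` over the leading orders `s = K+1, …, 2K+1`. -/
def etaSum (K : ℕ) (x : ℝ) : ℝ := ∑ s ∈ Finset.Icc (K + 1) (2 * K + 1), H.eta K x s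

/-- The probability of a term given its order `s`: multinomial for the powers, and independent
choices `l_i ~ p = α / λ`. -/
def termProb {K s : ℕ} (i : TermIdx L K s) : ℝ :=
  (Nat.multinomial Finset.univ i.1.1 : ℝ) *
    (H.lam / H.rate K) ^ (i.1.1 none) *
    (∏ j, (H.coeff ((remStages L K).get j).1 * |((remStages L K).get j).2| / H.rate K) ^
      (i.1.1 (some j))) *
    ∏ a, H.coeff (i.2 a) / H.lam

/-- The `s` Pauli factors (with phases) of a term of order `s`: `-i P_{l_1}, …, -i P_{l_r}`, and
then `i sgn(τ) P_l`, repeated as often as its power says, for each stage `(l, τ)` of `S_K(x)†`. -/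
def termGates {K s : ℕ} (i : TermIdx L K s) : List (Op n) :=
  List.ofFn (fun a => (-Complex.I) • H.P (i.2 a)) ++
    (List.ofFn fun j => List.replicate (i.1.1 (some j))
      ((Complex.I * ((Real.sign ((remStages L K).get j).2 : ℝ) : ℂ)) •
        H.P ((remStages L K).get j).1)).flatten

/-- The unitary of a term, a Pauli operator up to a power of `i`. -/
def termOp {K s : ℕ} (i : TermIdx L K s) : Op n := (H.termGates i).prod

open Classical in
/-- The Hermitian Pauli operator of a term: the extra factor `-i` if the term is anti-Hermitian. -/
def hermOp {K s : ℕ} (i : TermIdx L K s) : Op n :=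
  if (H.termOp i)ᴴ = -H.termOp i then (-Complex.I) • H.termOp i else H.termOp i

/-! ### The paired formula of one segment and of `ν` segments -/

/-- The coefficients of the paired LCU formula of `V_K(x)`. -/
def segCoeff (K sc : ℕ) (x : ℝ) (i : SegIdx L K sc) : ℝ :=
  if i.1.1 ≤ 2 * K + 1 then
    Real.sqrt (1 + H.etaSum K x ^ 2) * (H.eta K x i.1.1 / H.etaSum K x) * H.termProb i.2
  else H.eta K x i.1.1 * H.termProb i.2

/-- The circuits of the elementary unitaries of the paired LCU formula of `V_K(x)`: one Pauli
rotation `exp (i θ P')`, `θ = arctan η_Σ`, for the leading orders, and the `s` Pauli operators of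
the term for the orders `s ≥ 2K+2`. -/
def segGates (K sc : ℕ) (x : ℝ) (i : SegIdx L K sc) : List (Op n) :=
  if i.1.1 ≤ 2 * K + 1 then
    [NormedSpace.exp ((Complex.I * (Real.arctan (H.etaSum K x) : ℂ)) • H.hermOp i.2)]
  else H.termGates i.2

/-- The elementary unitaries of the paired LCU formula of `V_K(x)`. -/
def segOp (K sc : ℕ) (x : ℝ) (i : SegIdx L K sc) : Op n := (H.segGates K sc x i).prod

/-- The 1-norm `μ_K^{(p)}(x)` of one segment. -/
def segNorm (K sc : ℕ) (x : ℝ) : ℝ :=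
  Real.sqrt (1 + H.etaSum K x ^ 2) + ∑ s ∈ Finset.Icc (2 * K + 2) sc, H.eta K x s

/-- The coefficients of the product of `ν` segments, each of duration `t / ν`. -/
def totCoeff (K sc ν : ℕ) (t : ℝ) (i : Fin ν → SegIdx L K sc) : ℝ :=
  ∏ a, H.segCoeff K sc (t / ν) (i a)

/-- The elementary unitaries of the product of `ν` segments, each of them the Trotter formula
followed by the compensation. -/
def totOp (K sc ν : ℕ) (t : ℝ) (i : Fin ν → SegIdx L K sc) : Op n :=
  (List.ofFn fun a => H.segOp K sc (t / ν) (i a) * H.S K (t / ν)).prod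

end Hamiltonian

/-! ### LCU formulas -/

/-- `∑ᵢ cᵢ Wᵢ`, with `cᵢ > 0` and unitary `Wᵢ`, is a `(μ, ε)`-LCU formula of `V`: its 1-norm
`∑ᵢ cᵢ` is `μ`, so that `cᵢ = μ Pr(i)`, and its spectral norm distance to `V` is at most `ε`. -/
def IsLCU {n : ℕ} {ι : Type} [Fintype ι] (c : ι → ℝ) (W : ι → Op n) (μ ε : ℝ) (V : Op n) : Prop :=
  (∀ i, 0 < c i) ∧ (∀ i, W i ∈ Matrix.unitaryGroup (Basis n) ℂ) ∧ ∑ i, c i = μ ∧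
    ‖V - ∑ i, (c i : ℂ) • W i‖ ≤ ε

/-! ### Thresholds -/

/-- The principal branch `W₀` of the Lambert function: for `y ≥ -1/e` the solution `w ≥ -1` of
`w e^w = y`. -/
def lambertW (y : ℝ) : ℝ :=
  Function.invFunOn (fun w : ℝ => w * Real.exp w) (Set.Ici (-1)) y

/-- The constant in the exponent of the bound for the 1-norm of a segment: `3/2` for `K = 0`,
`e + 2/9` for `K = 1` and `e + c_k`, `c_k = (e/(2k+1))^{4k+2} / 2`, for `K = 2k ≥ 2`. -/
def pairConst (K : ℕ) : ℝ :=
  if K = 0 then 3 / 2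
  else if K = 1 then Real.exp 1 + 2 / 9
  else Real.exp 1 + 1 / 2 * (Real.exp 1 / ((K : ℝ) + 1)) ^ (2 * K + 2)

namespace Hamiltonian

variable {n L : ℕ} (H : Hamiltonian n L)

/-- `ν_K^{(p)}(t)`. -/
def nuP (K : ℕ) (t μ : ℝ) : ℝ :=
  (pairConst K * (H.rate K * t) / Real.log μ) ^ (1 / (2 * (K : ℝ) + 1)) * (H.rate K * t)

/-- The threshold for the number of segments. -/
def nuMin (K : ℕ) (t μ : ℝ) : ℝ :=
  if K = 0 then H.nuP K t μ else max (H.nuP K t μ) (H.rate K * t)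

/-- The threshold for the truncation order. -/
def scMin (K : ℕ) (t μ ε : ℝ) : ℕ :=
  max ⌈Real.log (μ / ε * H.nuP K t μ) /
      lambertW (1 / (Real.exp 1 * (H.rate K * t)) * H.nuP K t μ *
        Real.log (μ / ε * H.nuP K t μ)) - 1⌉₊
    (max 2 (2 * K + 1))

end Hamiltonian

/-! ### The random-sampling circuit -/

/-- Operators on one ancillary qubit and `n` system qubits. -/
abbrev OpA (n : ℕ) : Type := Matrix (Fin 2 × Basis n) (Fin 2 × Basis n) ℂ

/-- `|b⟩⟨b|` on the ancilla. -/
def proj (b : Fin 2) : Matrix (Fin 2) (Fin 2) ℂ := Matrix.single b b 1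

/-- `G` on the system, without control. -/
def onSystem {n : ℕ} (G : Op n) : OpA n := (1 : Matrix (Fin 2) (Fin 2) ℂ) ⊗ₖ G

/-- `G` on the system, controlled on the ancilla being in state `b`. -/
def ctrl {n : ℕ} (b : Fin 2) (G : Op n) : OpA n := proj b ⊗ₖ G + (1 - proj b) ⊗ₖ (1 : Op n)

/-- The system gates: Pauli gates (with a phase) and Pauli rotations. -/
def IsSystemGate {n : ℕ} (G : Op n) : Prop :=
  ∃ σ : Fin n → Pauli, (∃ z : ℂ, ‖z‖ = 1 ∧ G = z • pauliOp σ) ∨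
    ∃ θ : ℝ, G = NormedSpace.exp ((Complex.I * (θ : ℂ)) • pauliOp σ)

/-- The elementary gates, each of cost one: system gates and controlled system gates. -/
def IsGate {n : ℕ} (M : OpA n) : Prop :=
  ∃ G : Op n, IsSystemGate G ∧ (M = onSystem G ∨ ∃ b, M = ctrl b G)

namespace Hamiltonian

variable {n L : ℕ} (H : Hamiltonian n L)

/-- The gates between the preparation of the ancilla and the measurement, for two independently
sampled labels `i`, `j`: in every segment, the Trotter circuit without control, then the sampled
compensation for `i` controlled on `1` and the one for `j` controlled on `0`. -/
def samplingCircuit (K sc ν : ℕ) (t : ℝ) (i j : Fin ν → SegIdx L K sc) : List (OpA n) :=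
  (List.ofFn fun a =>
    (H.segGates K sc (t / ν) (j a)).map (ctrl 0) ++
    (H.segGates K sc (t / ν) (i a)).map (ctrl 1) ++
    (H.trotterGates K (t / ν)).map onSystem).flatten

end Hamiltonian

end PTS

end

open scoped Matrix Kronecker Matrix.Norms.L2Operator

noncomputable section

namespace PTS

/-! ### Formal power series with coefficients in a noncommutative algebra -/

section FormalSeries

variable {A : Type*} [Ring A]

/-! The Trotter remainder V = U S_K† is unitary and equals 1 through degree K. Hence (V - 1)(V† - 1)
= -(V - 1) - (V† - 1), and the left side starts only in degree 2K+2. All Taylor coefficients of V in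
degrees 1, …, 2K+1 are therefore anti-Hermitian (`star_coeff_remSeries`). Each expansion term is a
Pauli operator up to a power of i, so within such a degree the Hermitian terms cancel, and every P
may be replaced by iP' without changing the sum (`sum_hermOp`). Pairing with the identity, 1 + iη P'
= √(1+η²) exp(iθP') with θ = arctan η. The leading orders thus cost only 1 + O(x^(2K+2)) in 1-norm,
while their sum is still exactly the Taylor polynomial of V (`sum_segOp`).

That V is 1 through degree K is proved for formal power series over a noncommutative algebra. The
leading defects of formulas add under products and scale like c^m under a change of step. Suzuki's
u_k makes them cancel in odd degree m, and the palindromic order of the stages kills the next, even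
degree (`suzuki_order`, `remainder_order`).

For the quantitative part, one segment has 1-norm at most exp(C y^(2K+2)) with y = Λ_K t/ν
(`segNorm_le`), so ν segments stay below μ once ν ≥ ν_K(t) and, for K ≥ 1, y ≤ 1. The error of a
segment is a tail of the exponential series, and telescoping multiplies it by at most νμ
(`isLCU_tot`). The tail is controlled by (ey/m)^m, which the Lambert function inverts
(`expTail_le_exp_neg`). If the logarithm in the threshold is not positive, Λ_K t is so small that
the minimal truncation order suffices (`truncation_error_le_of_small`). The gate count is ν(2s_c +
κ_K L), with both thresholds estimated uniformly in `exists_nuMin_le` and `exists_scMin_le`. -/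

/-- `f` and `g` agree below degree `m`. -/
def AgreeBelow (m : ℕ) (f g : PowerSeries A) : Prop :=
  ∀ s < m, PowerSeries.coeff s f = PowerSeries.coeff s g

theorem coeff_zero_mul' (f g : PowerSeries A) :
    PowerSeries.coeff 0 (f * g) = PowerSeries.coeff 0 f * PowerSeries.coeff 0 g := by
  simp [PowerSeries.coeff_mul]

/-- Lowest-order part of a product of two series, the first one vanishing below degree `m`. -/
theorem coeff_mul_of_vanish_left {m : ℕ} {f g : PowerSeries A}
    (hf : AgreeBelow m f 0) : ∀ s ≤ m, PowerSeries.coeff s (f * g) =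
      PowerSeries.coeff s f * PowerSeries.coeff 0 g := by
  intro s hs
  rw [PowerSeries.coeff_mul, Finset.sum_eq_single (s, 0)]
  · rintro ⟨a, b⟩ hab hne
    have hab' := Finset.HasAntidiagonal.mem_antidiagonal.1 hab
    have : a < m := by
      rcases Nat.eq_zero_or_pos b with rfl | hb
      · exact absurd (by simpa using hab') (by simpa using hne)
      · simp only at hab'; omega
    simp [hf a this]
  · intro h; simp at h

theorem coeff_mul_of_vanish_right {m : ℕ} {f g : PowerSeries A}
    (hg : AgreeBelow m g 0) : ∀ s ≤ m, PowerSeries.coeff s (f * g) =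
      PowerSeries.coeff 0 f * PowerSeries.coeff s g := by
  intro s hs
  rw [PowerSeries.coeff_mul, Finset.sum_eq_single (0, s)]
  · rintro ⟨a, b⟩ hab hne
    have hab' := Finset.HasAntidiagonal.mem_antidiagonal.1 hab
    have : b < m := by
      rcases Nat.eq_zero_or_pos a with rfl | hb
      · exact absurd (by simpa using hab') (by simpa using hne)
      · simp only at hab'; omega
    simp [hg b this]
  · intro h; simp at h

theorem AgreeBelow.mul_vanish {m m' : ℕ} {f g : PowerSeries A} (hf : AgreeBelow m f 0)
    (hg : AgreeBelow m' g 0) : AgreeBelow (m + m') (f * g) 0 := by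
  intro s hs
  rw [PowerSeries.coeff_mul, map_zero]
  refine Finset.sum_eq_zero fun p hp => ?_
  have := Finset.HasAntidiagonal.mem_antidiagonal.1 hp
  by_cases h : p.1 < m
  · simp [hf _ h]
  · simp [hg p.2 (by omega)]

theorem AgreeBelow.sub_vanish {m : ℕ} {f g : PowerSeries A} (h : AgreeBelow m f g) :
    AgreeBelow m (f - g) 0 := fun s hs => by simp [h s hs]

variable [Algebra ℂ A]

/-! ### Formal exponentials and their products -/

/-- The power series of `x ↦ exp (x Z)`. -/
def expPS (Z : A) : PowerSeries A := PowerSeries.mk fun k => ((k.factorial : ℂ)⁻¹) • Z ^ k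

/-- The power series of `x ↦ exp (x Z₁) exp (x Z₂) ⋯`. -/
def prodExp (l : List A) : PowerSeries A := (l.map expPS).prod

/-- Substitution of `c X` for `X`. -/
def scalePS (c : ℂ) (f : PowerSeries A) : PowerSeries A :=
  PowerSeries.mk fun k => c ^ k • PowerSeries.coeff k f

theorem coeff_expPS (Z : A) (k : ℕ) :
    PowerSeries.coeff k (expPS Z) = ((k.factorial : ℂ)⁻¹) • Z ^ k := PowerSeries.coeff_mk _ _

theorem coeff_scalePS (c : ℂ) (f : PowerSeries A) (k : ℕ) :
    PowerSeries.coeff k (scalePS c f) = c ^ k • PowerSeries.coeff k f := PowerSeries.coeff_mk _ _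

theorem coeff_zero_expPS (Z : A) : PowerSeries.coeff 0 (expPS Z) = 1 := by
  simp [coeff_expPS]

theorem scalePS_mul (c : ℂ) (f g : PowerSeries A) :
    scalePS c (f * g) = scalePS c f * scalePS c g := by
  ext s
  rw [coeff_scalePS, PowerSeries.coeff_mul, PowerSeries.coeff_mul, Finset.smul_sum]
  refine Finset.sum_congr rfl fun p hp => ?_
  rw [coeff_scalePS, coeff_scalePS, smul_mul_smul_comm, ← pow_add,
    Finset.HasAntidiagonal.mem_antidiagonal.1 hp]

theorem scalePS_one (c : ℂ) : scalePS c (1 : PowerSeries A) = 1 := by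
  ext s
  rw [coeff_scalePS, PowerSeries.coeff_one]
  split_ifs with h <;> simp [h]

theorem scalePS_expPS (c : ℂ) (Z : A) : scalePS c (expPS Z) = expPS (c • Z) := by
  ext s
  rw [coeff_scalePS, coeff_expPS, coeff_expPS, smul_pow, smul_comm]

theorem prodExp_nil : prodExp ([] : List A) = 1 := rfl

theorem prodExp_cons (Z : A) (l : List A) : prodExp (Z :: l) = expPS Z * prodExp l := by
  simp [prodExp]

theorem prodExp_append (l l' : List A) : prodExp (l ++ l') = prodExp l * prodExp l' := by
  simp [prodExp]

theorem scalePS_prodExp (c : ℂ) (l : List A) :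
    scalePS c (prodExp l) = prodExp (l.map (c • ·)) := by
  induction l with
  | nil => exact scalePS_one c
  | cons Z l ih => rw [prodExp_cons, scalePS_mul, ih, scalePS_expPS, List.map_cons, prodExp_cons]

/-- The scalar identity e^(aX) e^(bX) = e^((a+b)X), read off in degree s. Multiples of one element Z
commute, so it transfers to `expPS`. -/
theorem sum_antidiagonal_exp (a b : ℂ) (s : ℕ) :
    ∑ p ∈ Finset.HasAntidiagonal.antidiagonal s,
      ((p.1.factorial : ℂ)⁻¹ * a ^ p.1) * ((p.2.factorial : ℂ)⁻¹ * b ^ p.2) =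
      (s.factorial : ℂ)⁻¹ * (a + b) ^ s := by
  have h := congrArg (PowerSeries.coeff s) (PowerSeries.exp_mul_exp_eq_exp_add a b)
  rw [PowerSeries.coeff_mul] at h
  simp only [PowerSeries.coeff_rescale, PowerSeries.coeff_exp] at h
  simp only [one_div, map_inv₀, map_natCast] at h
  rw [mul_comm, ← h]
  exact Finset.sum_congr rfl fun p _ => by ring

theorem expPS_smul_mul_expPS_smul (a b : ℂ) (Z : A) :
    expPS (a • Z) * expPS (b • Z) = expPS ((a + b) • Z) := by
  ext s
  rw [PowerSeries.coeff_mul, coeff_expPS, smul_pow, smul_smul, ← sum_antidiagonal_exp,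
    Finset.sum_smul]
  refine Finset.sum_congr rfl fun p hp => ?_
  rw [coeff_expPS, coeff_expPS, smul_pow, smul_pow, smul_smul, smul_smul, smul_mul_smul_comm,
    ← pow_add, Finset.HasAntidiagonal.mem_antidiagonal.1 hp]

theorem expPS_zero : expPS (0 : A) = 1 := by
  ext s
  rw [coeff_expPS, PowerSeries.coeff_one]
  split_ifs with h <;> simp [h]

theorem expPS_mul_expPS_neg (Z : A) : expPS Z * expPS (-Z) = 1 := by
  have h := expPS_smul_mul_expPS_smul 1 (-1) Z
  simpa [expPS_zero] using h

theorem prodExp_mul_reverse_neg (l : List A) :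
    prodExp l * prodExp (l.reverse.map (- ·)) = 1 := by
  induction l with
  | nil => simp [prodExp_nil]
  | cons Z l ih =>
    rw [List.reverse_cons, List.map_append, prodExp_append, prodExp_cons, mul_assoc,
      ← mul_assoc (prodExp l), ih, one_mul]
    simpa [prodExp] using expPS_mul_expPS_neg Z

theorem coeff_zero_prodExp (l : List A) : PowerSeries.coeff 0 (prodExp l) = 1 := by
  induction l with
  | nil => simp [prodExp_nil]
  | cons Z l ih => rw [prodExp_cons, coeff_zero_mul', ih, coeff_zero_expPS, one_mul]

theorem coeff_one_prodExp (l : List A) : PowerSeries.coeff 1 (prodExp l) = l.sum := by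
  induction l with
  | nil => simp [prodExp_nil, PowerSeries.coeff_one]
  | cons Z l ih =>
    rw [prodExp_cons, PowerSeries.coeff_mul, Finset.Nat.antidiagonal_succ]
    simp [coeff_zero_prodExp, ih, coeff_expPS, add_comm]

/-- `f` agrees with `exp (a X Z)` below degree `m` and differs from it by `d` in degree `m`. -/
def ExpUpTo (Z : A) (m : ℕ) (f : PowerSeries A) (a : ℂ) (d : A) : Prop :=
  AgreeBelow m f (expPS (a • Z)) ∧
    PowerSeries.coeff m f = PowerSeries.coeff m (expPS (a • Z)) + d

/-- In degree m a defect meets only the constant term of the other factor. That term is 1 because m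
> 0, so defects add even though nothing commutes. -/
theorem ExpUpTo.mul {Z : A} {m : ℕ} (hm : 0 < m) {f g : PowerSeries A} {a b : ℂ} {d e : A}
    (hf : ExpUpTo Z m f a d) (hg : ExpUpTo Z m g b e) :
    ExpUpTo Z m (f * g) (a + b) (d + e) := by
  have key : ∀ s ≤ m, PowerSeries.coeff s (f * g) =
      PowerSeries.coeff s (expPS ((a + b) • Z)) + PowerSeries.coeff s (f - expPS (a • Z)) +
        PowerSeries.coeff s (g - expPS (b • Z)) := by
    intro s hs
    have h0 : f * g = expPS ((a + b) • Z) + (f - expPS (a • Z)) * g +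
        expPS (a • Z) * (g - expPS (b • Z)) := by
      rw [← expPS_smul_mul_expPS_smul]; noncomm_ring
    rw [h0, map_add, map_add, coeff_mul_of_vanish_left hf.1.sub_vanish s hs,
      coeff_mul_of_vanish_right hg.1.sub_vanish s hs, hg.1 0 hm, coeff_zero_expPS,
      coeff_zero_expPS, one_mul, mul_one]
  refine ⟨fun s hs => ?_, ?_⟩
  · rw [key s hs.le, map_sub, map_sub, hf.1 s hs, hg.1 s hs]; simp
  · rw [key m le_rfl, map_sub, map_sub, hf.2, hg.2]; abel

theorem ExpUpTo.scale {Z : A} {m : ℕ} {f : PowerSeries A} {d : A}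
    (hf : ExpUpTo Z m f 1 d) (c : ℂ) : ExpUpTo Z m (scalePS c f) c (c ^ m • d) := by
  have h1 : expPS (c • Z) = scalePS c (expPS ((1 : ℂ) • Z)) := by rw [scalePS_expPS, one_smul]
  refine ⟨fun s hs => ?_, ?_⟩
  · rw [h1, coeff_scalePS, coeff_scalePS, hf.1 s hs]
  · rw [h1, coeff_scalePS, coeff_scalePS, hf.2, smul_add]

/-- A time-symmetric formula that is correct to an odd order is correct to the next order. -/
theorem agreeBelow_succ_of_symmetric {Z : A} {m : ℕ} (hm : 0 < m) (he : Even m)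
    {f : PowerSeries A} (hf : AgreeBelow m f (expPS Z)) (hs : f * scalePS (-1) f = 1) :
    AgreeBelow (m + 1) f (expPS Z) := by
  set d := PowerSeries.coeff m f - PowerSeries.coeff m (expPS Z) with hd
  have h1 : ExpUpTo Z m f 1 d := by
    refine ⟨by simpa using hf, ?_⟩
    rw [one_smul, hd]; abel
  -- The defect of f(X) f(-X) = 1 is d + (-1)^m d, and m is even, so 2d = 0.
  have h2 := (h1.mul hm (h1.scale (-1))).2
  rw [hs, he.neg_one_pow, one_smul, add_neg_cancel, zero_smul, expPS_zero] at h2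
  have h3 : (2 : ℂ) • d = 0 := by rw [two_smul]; simpa using h2
  have h4 : d = 0 := by
    have := congrArg (fun v => (2 : ℂ)⁻¹ • v) h3
    simpa [smul_smul] using this
  intro s hsm
  rcases Nat.lt_succ_iff_lt_or_eq.1 hsm with h | rfl
  · exact hf s h
  · exact sub_eq_zero.1 (hd ▸ h4)

/-! ### Order conditions for the Trotter–Suzuki formulas -/

/-- The series of a Trotter formula with generators `h l`. -/
def stageSeries {L : ℕ} (h : Fin L → A) (st : List (Fin L × ℝ)) : PowerSeries A :=
  prodExp (st.map fun p => (p.2 : ℂ) • h p.1)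

theorem stageSeries_append {L : ℕ} (h : Fin L → A) (st st' : List (Fin L × ℝ)) :
    stageSeries h (st ++ st') = stageSeries h st * stageSeries h st' := by
  simp [stageSeries, prodExp_append]

theorem stageSeries_scaleStages {L : ℕ} (h : Fin L → A) (c : ℝ) (st : List (Fin L × ℝ)) :
    stageSeries h (scaleStages c st) = scalePS c (stageSeries h st) := by
  simp [stageSeries, scaleStages, scalePS_prodExp, Function.comp_def, smul_smul]

/-- Reversing the factors and negating the time inverts a product of exponentials. For a palindrome
the reversal does nothing. -/
theorem stageSeries_mul_neg_of_palindrome {L : ℕ} (h : Fin L → A) {st : List (Fin L × ℝ)}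
    (hst : st.reverse = st) : stageSeries h st * scalePS (-1) (stageSeries h st) = 1 := by
  rw [stageSeries, scalePS_prodExp]
  convert prodExp_mul_reverse_neg _ using 2
  rw [← List.map_reverse, hst]
  simp

theorem reverse_scaleStages {L : ℕ} (c : ℝ) (st : List (Fin L × ℝ)) :
    (scaleStages c st).reverse = scaleStages c st.reverse := by
  simp [scaleStages]

theorem suzukiStages_reverse (L k : ℕ) : (suzukiStages L k).reverse = suzukiStages L k := by
  induction k with
  | zero => rfl
  | succ k ih =>
    cases k with
    | zero => simp [suzukiStages, List.map_reverse]
    | succ k => simp [suzukiStages, reverse_scaleStages, ih]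

theorem sum_finRange_map {L : ℕ} {M : Type*} [AddCommMonoid M] (g : Fin L → M) :
    ((List.finRange L).map g).sum = ∑ l, g l := by
  rw [← List.ofFn_eq_map, List.sum_ofFn]

/-- With q = 4^(1/(2k-1)) one has 1 - 4u = -qu and q^(2k-1) = 4, so the odd powers cancel. The signs
ensure that no stage has length zero. -/
theorem suzukiU_two_le {k : ℕ} (hk : 2 ≤ k) : 0 < suzukiU k ∧ 1 - 4 * suzukiU k < 0 ∧
    4 * suzukiU k ^ (2 * k - 1) + (1 - 4 * suzukiU k) ^ (2 * k - 1) = 0 := by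
  have hk' : (2 : ℝ) ≤ k := by exact_mod_cast hk
  set q : ℝ := (4 : ℝ) ^ (1 / (2 * (k : ℝ) - 1)) with hq
  have hq0 : 0 < q := Real.rpow_pos_of_pos (by norm_num) _
  have hq4 : q < 4 := by
    calc q < (4 : ℝ) ^ (1 : ℝ) := by
          apply Real.rpow_lt_rpow_of_exponent_lt (by norm_num)
          rw [div_lt_one (by linarith)]; linarith
      _ = 4 := by norm_num
  have hu : suzukiU k = 1 / (4 - q) := rfl
  have hd : 0 < 4 - q := by linarith
  have h1 : 1 - 4 * suzukiU k = -(q * suzukiU k) := by rw [hu]; field_simp; ring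
  have hu0 : 0 < suzukiU k := by rw [hu]; positivity
  have hqp : q ^ (2 * k - 1) = 4 := by
    rw [hq, ← Real.rpow_natCast, ← Real.rpow_mul (by norm_num)]
    have : ((2 * k - 1 : ℕ) : ℝ) = 2 * (k : ℝ) - 1 := by
      rw [Nat.cast_sub (by omega)]; push_cast; ring
    rw [this, one_div_mul_cancel (by linarith), Real.rpow_one]
  refine ⟨hu0, ?_, ?_⟩
  · rw [h1]; nlinarith [mul_pos hq0 hu0]
  · have ho : Odd (2 * k - 1) := ⟨k - 1, by omega⟩
    rw [h1, ho.neg_pow, mul_pow, hqp]; ring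

/-- The formula `S_{2k}` is correct to order `2k`. -/
theorem suzuki_order {L : ℕ} (h : Fin L → A) (k : ℕ) :
    AgreeBelow (2 * k + 1) (stageSeries h (suzukiStages L k)) (expPS (∑ l, h l)) := by
  have sym := fun k => stageSeries_mul_neg_of_palindrome h (suzukiStages_reverse L k)
  induction k with
  | zero =>
    intro s hs
    obtain rfl : s = 0 := by omega
    rw [stageSeries, coeff_zero_prodExp, coeff_zero_expPS]
  | succ k ih =>
    -- Only the odd degree 2k+1 is left to be matched; time symmetry then supplies degree 2k+2.
    refine agreeBelow_succ_of_symmetric (m := 2 * (k + 1)) (by omega) (by simp) ?_ (sym _)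
    cases k with
    | zero =>
      intro s hs
      obtain rfl | rfl : s = 0 ∨ s = 1 := by omega
      · rw [stageSeries, coeff_zero_prodExp, coeff_zero_expPS]
      · rw [stageSeries, coeff_one_prodExp, coeff_expPS]
        simp only [suzukiStages, List.map_append, List.map_map, List.map_reverse,
          List.sum_append, List.sum_reverse, Function.comp_def, sum_finRange_map]
        rw [← Finset.sum_add_distrib]
        simp [← add_smul]
        norm_num
    | succ k =>
      set m := 2 * (k + 1) + 1 with hm
      set Z := ∑ l, h l
      set f := stageSeries h (suzukiStages L (k + 1))
      obtain ⟨-, -, hu⟩ := suzukiU_two_le (k := k + 2) (by omega)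
      have hm' : 2 * (k + 2) - 1 = m := by omega
      rw [hm'] at hu
      set u := suzukiU (k + 2)
      set d := PowerSeries.coeff m f - PowerSeries.coeff m (expPS Z) with hd
      have h1 : ExpUpTo Z m f 1 d := by
        refine ⟨by simpa using ih, ?_⟩
        rw [one_smul, hd]; abel
      have hA := h1.scale (u : ℂ)
      have hB := h1.scale ((1 - 4 * u : ℝ) : ℂ)
      have hm0 : 0 < m := by omega
      have h5 := (((hA.mul hm0 hA).mul hm0 hB).mul hm0 hA).mul hm0 hA
      have hser : stageSeries h (suzukiStages L (k + 2)) =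
          scalePS (u : ℂ) f * scalePS (u : ℂ) f * scalePS ((1 - 4 * u : ℝ) : ℂ) f *
            scalePS (u : ℂ) f * scalePS (u : ℂ) f := by
        simp only [suzukiStages, stageSeries_append, stageSeries_scaleStages]; rfl
      rw [← hser] at h5
      have ha : (u : ℂ) + u + ((1 - 4 * u : ℝ) : ℂ) + u + u = 1 := by push_cast; ring
      -- The five copies have total defect (4u^m + (1-4u)^m) d, which is zero by the choice of u.
      have hc : (u : ℂ) ^ m • d + (u : ℂ) ^ m • d + ((1 - 4 * u : ℝ) : ℂ) ^ m • d +
          (u : ℂ) ^ m • d + (u : ℂ) ^ m • d = 0 := by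
        have : (u : ℂ) ^ m + (u : ℂ) ^ m + ((1 - 4 * u : ℝ) : ℂ) ^ m +
          (u : ℂ) ^ m + (u : ℂ) ^ m = 0 := by
          have := congrArg (fun r : ℝ => (r : ℂ)) hu
          push_cast at this ⊢
          rw [← this]; ring
        rw [← add_smul, ← add_smul, ← add_smul, ← add_smul, this, zero_smul]
      rw [ha, hc] at h5
      intro s hs
      rcases (show s < m ∨ s = m by omega) with h' | rfl
      · simpa using h5.1 s h'
      · simpa using h5.2

/-- The formula `S_K` is correct to order `K`. -/
theorem trotter_order {L K : ℕ} (hK : K = 1 ∨ Even K) (h : Fin L → A) :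
    AgreeBelow (K + 1) (stageSeries h (trotterStages L K)) (expPS (∑ l, h l)) := by
  by_cases h1 : K = 1
  · subst h1
    intro s hs
    obtain rfl | rfl : s = 0 ∨ s = 1 := by omega
    · rw [stageSeries, coeff_zero_prodExp, coeff_zero_expPS]
    · rw [stageSeries, coeff_one_prodExp, coeff_expPS]
      simp [trotterStages, List.map_reverse, Function.comp_def, sum_finRange_map]
  · obtain ⟨k, rfl⟩ := hK.resolve_left h1
    have := suzuki_order h k
    rw [trotterStages, if_neg h1, show (k + k) / 2 = k by omega]
    rwa [two_mul] at this

/-- The Trotter remainder is `1` to order `K`. -/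
theorem remainder_order {L K : ℕ} (hK : K = 1 ∨ Even K) (h : Fin L → A) :
    AgreeBelow (K + 1) (expPS (∑ l, h l) *
      prodExp ((trotterStages L K).reverse.map fun p => -((p.2 : ℂ) • h p.1))) 1 := by
  set T := prodExp ((trotterStages L K).reverse.map fun p => -((p.2 : ℂ) • h p.1))
  have hinv : stageSeries h (trotterStages L K) * T = 1 := by
    have := prodExp_mul_reverse_neg ((trotterStages L K).map fun p => (p.2 : ℂ) • h p.1)
    simpa [stageSeries, T, ← List.map_reverse, Function.comp_def] using this
  have hv : AgreeBelow (K + 1) (expPS (∑ l, h l) - stageSeries h (trotterStages L K)) 0 :=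
    fun s hs => by simp [trotter_order hK h s hs]
  -- V - 1 = (U - S) S⁻¹, and the first factor vanishes through degree K.
  have heq : expPS (∑ l, h l) * T =
      1 + (expPS (∑ l, h l) - stageSeries h (trotterStages L K)) * T := by
    rw [sub_mul, hinv]; abel
  intro s hs
  rw [heq, map_add, coeff_mul_of_vanish_left hv s hs.le, hv s hs]
  simp

variable [StarRing A] [StarModule ℂ A]

/-- For a product of exponentials of skew-adjoint elements that is `1` below degree `m`, the
coefficients below degree `2m` are skew-adjoint, except for the constant one. -/
theorem star_coeff_prodExp {m : ℕ} {l : List A} (hl : ∀ Z ∈ l, star Z = -Z)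
    (h1 : AgreeBelow m (prodExp l) 1) {s : ℕ} (hs0 : 0 < s) (hs : s < 2 * m) :
    star (PowerSeries.coeff s (prodExp l)) = -PowerSeries.coeff s (prodExp l) := by
  -- The star reverses products and negates each generator, so the formal inverse of the product is
  -- its adjoint.
  have hstar : ∀ l : List A, (∀ Z ∈ l, star Z = -Z) → ∀ s,
      PowerSeries.coeff s (prodExp (l.reverse.map (- ·))) =
        star (PowerSeries.coeff s (prodExp l)) := by
    intro l
    induction l with
    | nil =>
      intro _ s
      simp only [List.reverse_nil, List.map_nil, prodExp_nil, PowerSeries.coeff_one]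
      split_ifs <;> simp
    | cons Z l ih =>
      intro hl s
      rw [List.reverse_cons, List.map_append, prodExp_append, prodExp_cons, PowerSeries.coeff_mul,
        PowerSeries.coeff_mul, star_sum, ← Finset.Nat.sum_antidiagonal_swap]
      refine Finset.sum_congr rfl fun p _ => ?_
      have h2 : PowerSeries.coeff p.1 (prodExp (List.map (- ·) [Z])) =
          star (PowerSeries.coeff p.1 (expPS Z)) := by
        simp [prodExp, coeff_expPS, hl Z (by simp)]
      rw [Prod.fst_swap, Prod.snd_swap, ih (fun Y hY => hl Y (by simp [hY])), h2, star_mul]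
  set f := prodExp l
  set g := prodExp (l.reverse.map (- ·))
  have hfg : f * g = 1 := prodExp_mul_reverse_neg l
  have hg1 : AgreeBelow m g 1 := by
    intro s hs
    rw [hstar l hl, h1 s hs, PowerSeries.coeff_one]
    split_ifs <;> simp
  -- Unitarity fg = 1 turns the sum of f - 1 and its adjoint into a product of two series that
  -- vanish below degree m, hence into one that vanishes below 2m.
  have hexp : (f - 1) * (g - 1) = -(f - 1) - (g - 1) := by
    have : (f - 1) * (g - 1) = f * g - f - g + 1 := by noncomm_ring
    rw [this, hfg]; abel
  have hv := (h1.sub_vanish.mul_vanish hg1.sub_vanish) s (by omega)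
  rw [hexp] at hv
  rw [← hstar l hl]
  have hz : PowerSeries.coeff s (1 : PowerSeries A) = 0 := by
    rw [PowerSeries.coeff_one, if_neg (by omega)]
  simp only [map_sub, map_neg, hz, map_zero, sub_zero] at hv
  exact (neg_eq_of_add_eq_zero_right (by rw [← neg_eq_zero, ← hv]; abel)).symm

end FormalSeries

/-! ### Expansion of ordered products -/

section OrderedProducts

variable {A : Type*} [Ring A]

/-- An ordered product of sums is the sum of all ordered products. -/
theorem prod_ofFn_sum {ι : Type*} [Fintype ι] (r : ℕ) (f : Fin r → ι → A) :
    (List.ofFn fun a => ∑ i, f a i).prod = ∑ g : Fin r → ι, (List.ofFn fun a => f a (g a)).prod := by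
  induction r with
  | zero => simp
  | succ r ih =>
    rw [List.ofFn_succ, List.prod_cons, ih, Finset.sum_mul_sum,
      ← (Fin.consEquiv fun _ => ι).sum_comp, Fintype.sum_prod_type]
    refine Finset.sum_congr rfl fun i _ => Finset.sum_congr rfl fun g _ => ?_
    simp [List.ofFn_succ, Fin.consEquiv]

theorem prod_ofFn_smul [Algebra ℂ A] (r : ℕ) (c : Fin r → ℂ) (f : Fin r → A) :
    (List.ofFn fun a => c a • f a).prod = (∏ a, c a) • (List.ofFn f).prod := by
  induction r with
  | zero => simp
  | succ r ih => 
    rw [List.ofFn_succ, List.prod_cons, ih, smul_mul_smul_comm, Fin.prod_univ_succ,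
      List.ofFn_succ, List.prod_cons]

/-- Iterated Cauchy product, with one summand for each way to distribute the degree over the ordered
factors. These exponent vectors become the powers in `TermIdx`. -/
theorem coeff_prod_ofFn (q : ℕ) (f : Fin q → PowerSeries A) (s : ℕ) :
    PowerSeries.coeff s (List.ofFn f).prod =
      ∑ m ∈ Finset.piAntidiag Finset.univ s,
        (List.ofFn fun j => PowerSeries.coeff (m j) (f j)).prod := by
  induction q generalizing s with
  | zero =>
    rw [List.ofFn_zero, List.prod_nil, PowerSeries.coeff_one, Finset.univ_eq_empty,
      Finset.piAntidiag_empty]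
    split_ifs <;> simp
  | succ q ih =>
    rw [List.ofFn_succ, List.prod_cons, PowerSeries.coeff_mul]
    simp_rw [ih, Finset.mul_sum]
    rw [Finset.sum_sigma']
    refine Finset.sum_nbij' (fun x => Fin.cons x.1.1 x.2)
      (fun m => ⟨(m 0, ∑ j, Fin.tail m j), Fin.tail m⟩) ?_ ?_ ?_ ?_ ?_
    · rintro ⟨⟨a, b⟩, m⟩ h
      simp only [Finset.mem_sigma, Finset.HasAntidiagonal.mem_antidiagonal,
        Finset.mem_piAntidiag] at h ⊢
      simp [Fin.sum_univ_succ, h.2.1, h.1]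
    · intro m h
      simp only [Finset.mem_piAntidiag, Fin.sum_univ_succ] at h
      simpa [Fin.tail, Finset.mem_piAntidiag] using ⟨h.1, rfl⟩
    · rintro ⟨⟨a, b⟩, m⟩ h
      simp only [Finset.mem_sigma, Finset.mem_piAntidiag] at h
      simp [h.2.1]
    · intro m _
      simp
    · rintro ⟨⟨a, b⟩, m⟩ _
      simp [List.ofFn_succ]

/-- The index `none` belongs to the separate leading factor, later the series of U(x). -/
theorem coeff_mul_prod_ofFn (q : ℕ) (f₀ : PowerSeries A) (f : Fin q → PowerSeries A) (s : ℕ) :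
    PowerSeries.coeff s (f₀ * (List.ofFn f).prod) =
      ∑ m ∈ Finset.piAntidiag (Finset.univ : Finset (Option (Fin q))) s,
        PowerSeries.coeff (m none) f₀ *
          (List.ofFn fun j => PowerSeries.coeff (m (some j)) (f j)).prod := by
  rw [PowerSeries.coeff_mul]
  simp_rw [coeff_prod_ofFn, Finset.mul_sum]
  rw [Finset.sum_sigma']
  refine Finset.sum_nbij' (fun x o => o.elim x.1.1 x.2)
    (fun m => ⟨(m none, ∑ j, m (some j)), fun j => m (some j)⟩) ?_ ?_ ?_ ?_ ?_
  · rintro ⟨⟨a, b⟩, m⟩ h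
    simp only [Finset.mem_sigma, Finset.HasAntidiagonal.mem_antidiagonal,
      Finset.mem_piAntidiag] at h ⊢
    simp [Fintype.sum_option, h.2.1, h.1]
  · intro m h
    simp only [Finset.mem_piAntidiag, Fintype.sum_option] at h
    simp [h.1]
  · rintro ⟨⟨a, b⟩, m⟩ h
    simp only [Finset.mem_sigma, Finset.mem_piAntidiag] at h
    simp [h.2.1]
  · intro m _
    funext o
    cases o <;> rfl
  · rintro ⟨⟨a, b⟩, m⟩ _
    simp

end OrderedProducts

/-! ### Values of power series -/

section Values

variable {A : Type*} [NormedRing A] [NormedAlgebra ℂ A]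

/-- The series `f` converges absolutely at `x`, with value `v`. -/
def SumsTo (f : PowerSeries A) (x : ℂ) (v : A) : Prop :=
  (Summable fun k => ‖x ^ k • PowerSeries.coeff k f‖) ∧
    HasSum (fun k => x ^ k • PowerSeries.coeff k f) v

theorem sumsTo_one (x : ℂ) : SumsTo (1 : PowerSeries A) x 1 := by
  have h0 : ∀ k ≠ 0, x ^ k • PowerSeries.coeff k (1 : PowerSeries A) = 0 := fun k hk => by
    simp [PowerSeries.coeff_one, hk]
  refine ⟨summable_of_ne_finset_zero (s := {0}) fun k hk => ?_, ?_⟩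
  · rw [h0 k (by simpa using hk), norm_zero]
  · simpa using hasSum_single 0 h0

/-- The exponential of a multiple of an involution. -/
theorem exp_I_smul_of_involution {Q : A} (hQ : Q * Q = 1) (θ : ℝ) :
    NormedSpace.exp ((Complex.I * (θ : ℂ)) • Q) =
      (Real.cos θ : ℂ) • (1 : A) + (Complex.I * (Real.sin θ : ℂ)) • Q := by
  have he : ∀ k : ℕ, Q ^ (2 * k) = 1 := fun k => by rw [pow_mul, pow_two, hQ, one_pow]
  have h1 : HasSum (fun k : ℕ => ((2 * k).factorial : ℂ)⁻¹ • ((Complex.I * (θ : ℂ)) • Q) ^ (2 * k))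
      ((Real.cos θ : ℂ) • (1 : A)) := by
    have := (Complex.hasSum_cos' (θ : ℂ)).smul_const (1 : A)
    rw [← Complex.ofReal_cos] at this
    convert this using 2 with k
    rw [smul_pow, he, smul_smul, mul_comm Complex.I, div_eq_inv_mul]
  have h2 : HasSum (fun k : ℕ => ((2 * k + 1).factorial : ℂ)⁻¹ •
      ((Complex.I * (θ : ℂ)) • Q) ^ (2 * k + 1)) ((Complex.I * (Real.sin θ : ℂ)) • Q) := by
    have := ((Complex.hasSum_sin' (θ : ℂ)).mul_left Complex.I).smul_const Q
    rw [← Complex.ofReal_sin] at this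
    convert this using 2 with k
    rw [smul_pow, pow_succ Q, he, one_mul, smul_smul, mul_comm Complex.I (θ : ℂ),
      mul_div_cancel₀ _ Complex.I_ne_zero, div_eq_inv_mul]
  have h3 := h1.even_add_odd (f := fun k : ℕ => (k.factorial : ℂ)⁻¹ •
      ((Complex.I * (θ : ℂ)) • Q) ^ k) h2
  rw [NormedSpace.exp_eq_tsum ℂ]
  exact h3.tsum_eq

variable [CompleteSpace A]

/-- Absolute convergence makes the Cauchy product converge to the product of the values; for this
reason `SumsTo` includes it. -/
theorem SumsTo.mul {f g : PowerSeries A} {x : ℂ} {v w : A} (hf : SumsTo f x v)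
    (hg : SumsTo g x w) : SumsTo (f * g) x (v * w) := by
  have hterm : ∀ k, x ^ k • PowerSeries.coeff k (f * g) =
      ∑ p ∈ Finset.HasAntidiagonal.antidiagonal k,
        (x ^ p.1 • PowerSeries.coeff p.1 f) * (x ^ p.2 • PowerSeries.coeff p.2 g) := fun k => by
    rw [PowerSeries.coeff_mul, Finset.smul_sum]
    refine Finset.sum_congr rfl fun p hp => ?_
    rw [smul_mul_smul_comm, ← pow_add, Finset.HasAntidiagonal.mem_antidiagonal.1 hp]
  have hsum := summable_norm_sum_mul_antidiagonal_of_summable_norm hf.1 hg.1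
  refine ⟨by simpa only [hterm] using hsum, ?_⟩
  simp only [hterm]
  rw [← hf.2.tsum_eq, ← hg.2.tsum_eq,
    tsum_mul_tsum_eq_tsum_sum_antidiagonal_of_summable_norm hf.1 hg.1]
  exact hsum.of_norm.hasSum

theorem sumsTo_expPS (Z : A) (x : ℂ) : SumsTo (expPS Z) x (NormedSpace.exp (x • Z)) := by
  have hterm : ∀ k, x ^ k • PowerSeries.coeff k (expPS Z) =
      ((k.factorial : ℂ)⁻¹) • (x • Z) ^ k := fun k => by
    rw [coeff_expPS, smul_pow, smul_comm]
  have hs := NormedSpace.norm_expSeries_summable' (𝕂 := ℂ) (x • Z)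
  refine ⟨by simpa only [hterm] using hs, ?_⟩
  simp only [hterm]
  rw [NormedSpace.exp_eq_tsum ℂ]
  exact hs.of_norm.hasSum

theorem sumsTo_prodExp (l : List A) (x : ℂ) :
    SumsTo (prodExp l) x (l.map fun Z => NormedSpace.exp (x • Z)).prod := by
  induction l with
  | nil => exact sumsTo_one x
  | cons Z l ih => rw [prodExp_cons, List.map_cons, List.prod_cons]; exact (sumsTo_expPS Z x).mul ih

theorem exp_neg_mul_exp (Z : A) : NormedSpace.exp (-Z) * NormedSpace.exp Z = 1 := by
  let _ : NormedAlgebra ℚ A := NormedAlgebra.restrictScalars ℚ ℂ A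
  rw [← NormedSpace.exp_add_of_commute (Commute.neg_left rfl), neg_add_cancel, NormedSpace.exp_zero]

theorem prod_exp_neg_reverse_mul (l : List A) :
    (l.reverse.map fun Z => NormedSpace.exp (-Z)).prod * (l.map NormedSpace.exp).prod = 1 := by
  induction l with
  | nil => simp
  | cons Z l ih =>
    rw [List.reverse_cons, List.map_append, List.prod_append, List.map_singleton,
      List.prod_singleton, List.map_cons, List.prod_cons, mul_assoc,
      ← mul_assoc (NormedSpace.exp (-Z)), exp_neg_mul_exp, one_mul, ih]

end Values

/-! ### Pauli operators -/

theorem Pauli.mat_mul (a b : Pauli) : ∃ (z : ℂ) (c : Pauli), z ^ 4 = 1 ∧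
    a.mat * b.mat = z • c.mat := by
  have hI : Complex.I ^ 4 = 1 := Complex.I_pow_four
  have hI' : (-Complex.I) ^ 4 = 1 := by rw [Even.neg_pow (by decide), hI]
  cases a <;> cases b
  · exact ⟨1, .I, by simp, by simp [Pauli.mat]⟩
  · exact ⟨1, .X, by simp, by simp [Pauli.mat]⟩
  · exact ⟨1, .Y, by simp, by simp [Pauli.mat]⟩
  · exact ⟨1, .Z, by simp, by simp [Pauli.mat]⟩
  · exact ⟨1, .X, by simp, by simp [Pauli.mat]⟩
  · exact ⟨1, .I, by simp, by simp [Pauli.mat]⟩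
  · exact ⟨Complex.I, .Z, hI, by simp [Pauli.mat]⟩
  · exact ⟨-Complex.I, .Y, hI', by simp [Pauli.mat]⟩
  · exact ⟨1, .Y, by simp, by simp [Pauli.mat]⟩
  · exact ⟨-Complex.I, .Z, hI', by simp [Pauli.mat]⟩
  · exact ⟨1, .I, by simp, by simp [Pauli.mat]⟩
  · exact ⟨Complex.I, .X, hI, by simp [Pauli.mat]⟩
  · exact ⟨1, .Z, by simp, by simp [Pauli.mat]⟩
  · exact ⟨Complex.I, .Y, hI, by simp [Pauli.mat]⟩
  · exact ⟨-Complex.I, .X, hI', by simp [Pauli.mat]⟩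
  · exact ⟨1, .I, by simp, by simp [Pauli.mat]⟩

theorem Pauli.mat_mul_self (a : Pauli) : a.mat * a.mat = 1 := by
  cases a <;> simp [Pauli.mat, Matrix.one_fin_two]

theorem Pauli.mat_star (a : Pauli) (i j : Fin 2) : star (a.mat j i) = a.mat i j := by
  cases a <;> fin_cases i <;> fin_cases j <;> simp [Pauli.mat]

variable {n : ℕ}

theorem pauliOp_mul_apply (σ τ : Fin n → Pauli) (a b : Basis n) :
    (pauliOp σ * pauliOp τ) a b = ∏ q, ((σ q).mat * (τ q).mat) (a q) (b q) := by
  simp only [Matrix.mul_apply, pauliOp, Matrix.of_apply]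
  rw [Finset.prod_univ_sum, Fintype.piFinset_univ]
  simp [Finset.prod_mul_distrib]

theorem pauliOp_mul_self (σ : Fin n → Pauli) : pauliOp σ * pauliOp σ = 1 := by
  ext a b
  rw [pauliOp_mul_apply]
  by_cases h : a = b
  · subst h
    simp [Pauli.mat_mul_self]
  · rw [Matrix.one_apply_ne h]
    obtain ⟨q, hq⟩ := Function.ne_iff.1 h
    exact Finset.prod_eq_zero (Finset.mem_univ q) 
      (by rw [Pauli.mat_mul_self, Matrix.one_apply_ne hq])

theorem pauliOp_I : pauliOp (fun _ : Fin n => Pauli.I) = 1 := by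
  ext a b
  simp only [pauliOp, Matrix.of_apply]
  have hI : Pauli.I.mat = 1 := by simp [Pauli.mat, Matrix.one_fin_two]
  by_cases h : a = b
  · subst h
    simp [hI]
  · rw [Matrix.one_apply_ne h]
    obtain ⟨q, hq⟩ := Function.ne_iff.1 h
    exact Finset.prod_eq_zero (Finset.mem_univ q) (by rw [hI, Matrix.one_apply_ne hq])

theorem pauliOp_conjTranspose (σ : Fin n → Pauli) : (pauliOp σ)ᴴ = pauliOp σ := by
  ext a b
  simp only [Matrix.conjTranspose_apply, pauliOp, Matrix.of_apply, star_prod, Pauli.mat_star]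

theorem pauliOp_ne_zero (σ : Fin n → Pauli) : pauliOp σ ≠ 0 := fun h => by
  have := pauliOp_mul_self σ
  rw [h, mul_zero] at this
  exact zero_ne_one this

/-- Pauli operators up to a power of `i`. -/
def IsPhasedPauli (M : Op n) : Prop :=
  ∃ (z : ℂ) (σ : Fin n → Pauli), z ^ 4 = 1 ∧ M = z • pauliOp σ

theorem isPhasedPauli_one : IsPhasedPauli (1 : Op n) :=
  ⟨1, fun _ => .I, by simp, by rw [pauliOp_I, one_smul]⟩

theorem IsPhasedPauli.mul {M N : Op n} (hM : IsPhasedPauli M) (hN : IsPhasedPauli N) :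
    IsPhasedPauli (M * N) := by
  obtain ⟨z, σ, hz, rfl⟩ := hM
  obtain ⟨w, τ, hw, rfl⟩ := hN
  choose y ρ hy hρ using fun q => Pauli.mat_mul (σ q) (τ q)
  refine ⟨z * w * ∏ q, y q, ρ, ?_, ?_⟩
  · rw [mul_pow, mul_pow, hz, hw, ← Finset.prod_pow]; simp [hy]
  · rw [smul_mul_smul_comm, mul_smul (z * w)]
    congr 1
    ext a b
    rw [pauliOp_mul_apply]
    simp [hρ, pauliOp, Finset.prod_mul_distrib]

theorem isPhasedPauli_list_prod {l : List (Op n)} (hl : ∀ M ∈ l, IsPhasedPauli M) :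
    IsPhasedPauli l.prod := by
  induction l with
  | nil => exact isPhasedPauli_one
  | cons M l ih =>
    rw [List.prod_cons]
    exact (hl M (by simp)).mul (ih fun N hN => hl N (by simp [hN]))

theorem norm_eq_one_of_pow_four {z : ℂ} (hz : z ^ 4 = 1) : ‖z‖ = 1 :=
  Complex.norm_eq_one_of_pow_eq_one hz (by norm_num)

theorem eq_of_pow_four {z : ℂ} (hz : z ^ 4 = 1) :
    (z = 1 ∨ z = -1) ∨ (z = Complex.I ∨ z = -Complex.I) := by
  have h : (z - 1) * (z + 1) * ((z - Complex.I) * (z + Complex.I)) = 0 := by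
    have : (z - Complex.I) * (z + Complex.I) = z ^ 2 + 1 := by
      ring_nf; rw [Complex.I_sq]; ring
    rw [this]; linear_combination hz
  rcases mul_eq_zero.1 h with h | h <;> rcases mul_eq_zero.1 h with h | h
  · exact .inl (.inl (sub_eq_zero.1 h))
  · exact .inl (.inr (eq_neg_of_add_eq_zero_left h))
  · exact .inr (.inl (sub_eq_zero.1 h))
  · exact .inr (.inr (eq_neg_of_add_eq_zero_left h))

theorem smul_pauliOp_mem_unitary {z : ℂ} (hz : ‖z‖ = 1) (σ : Fin n → Pauli) :
    z • pauliOp σ ∈ Matrix.unitaryGroup (Basis n) ℂ := by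
  rw [Matrix.mem_unitaryGroup_iff, Matrix.star_eq_conjTranspose, Matrix.conjTranspose_smul,
    pauliOp_conjTranspose, smul_mul_smul_comm, pauliOp_mul_self]
  have : z * star z = 1 := by
    rw [Complex.star_def, Complex.mul_conj, Complex.normSq_eq_norm_sq, hz]; simp
  rw [this, one_smul]

theorem IsPhasedPauli.mem_unitary {M : Op n} (hM : IsPhasedPauli M) :
    M ∈ Matrix.unitaryGroup (Basis n) ℂ := by
  obtain ⟨z, σ, hz, rfl⟩ := hM
  exact smul_pauliOp_mem_unitary (norm_eq_one_of_pow_four hz) σ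

/-- A phased Pauli operator is Hermitian, or anti-Hermitian; in the second case `-i` times it is
Hermitian.  The Hermitian one of the two is a Pauli operator up to a sign. -/
theorem IsPhasedPauli.dichotomy {M : Op n} (hM : IsPhasedPauli M) :
    ∃ (ζ : ℝ) (σ : Fin n → Pauli), ζ ^ 2 = 1 ∧
      ((Mᴴ = -M ∧ (-Complex.I) • M = (ζ : ℂ) • pauliOp σ) ∨
        (Mᴴ = M ∧ Mᴴ ≠ -M ∧ M = (ζ : ℂ) • pauliOp σ)) := by
  obtain ⟨z, σ, hz, rfl⟩ := hM
  -- A signed Pauli operator is Hermitian and nonzero, hence not anti-Hermitian; so the test in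
  -- `hermOp` separates the two cases.
  have hne : ∀ ζ : ℝ, ζ ^ 2 = 1 → (ζ : ℂ) • pauliOp σ ≠ -((ζ : ℂ) • pauliOp σ) := by
    intro ζ hζ h
    have h0 : (ζ : ℂ) • pauliOp σ = 0 := by
      have h2 : (2 : ℂ) • ((ζ : ℂ) • pauliOp σ) = 0 := by
        rw [two_smul]; nth_rewrite 1 [h]; exact neg_add_cancel _
      exact (smul_eq_zero.1 h2).resolve_left two_ne_zero
    rcases smul_eq_zero.1 h0 with h1 | h1
    · rw [Complex.ofReal_eq_zero.1 h1] at hζ; norm_num at hζ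
    · exact pauliOp_ne_zero σ h1
  rcases eq_of_pow_four hz with (rfl | rfl) | (rfl | rfl)
  · have h := hne 1 (by norm_num)
    refine ⟨1, σ, by norm_num, .inr ⟨?_, ?_, ?_⟩⟩ <;> simp_all [pauliOp_conjTranspose]
  · have h := hne (-1) (by norm_num)
    refine ⟨-1, σ, by norm_num, .inr ⟨?_, ?_, ?_⟩⟩ <;> simp_all [pauliOp_conjTranspose]
  · refine ⟨1, σ, by norm_num, .inl ⟨?_, ?_⟩⟩
    · simp [pauliOp_conjTranspose]
    · simp [smul_smul]
  · refine ⟨-1, σ, by norm_num, .inl ⟨?_, ?_⟩⟩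
    · simp [pauliOp_conjTranspose]
    · simp [smul_smul]

theorem signed_pauliOp_mul_self {ζ : ℝ} (hζ : ζ ^ 2 = 1) (σ : Fin n → Pauli) :
    ((ζ : ℂ) • pauliOp σ) * ((ζ : ℂ) • pauliOp σ) = 1 := by
  rw [smul_mul_smul_comm, pauliOp_mul_self, ← Complex.ofReal_mul, ← pow_two, hζ]; simp

theorem exp_I_smul_pauliOp_mem_unitary (θ : ℝ) (σ : Fin n → Pauli) :
    NormedSpace.exp ((Complex.I * (θ : ℂ)) • pauliOp σ) ∈ Matrix.unitaryGroup (Basis n) ℂ := by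
  have h : star (pauliOp σ) = pauliOp σ := pauliOp_conjTranspose σ
  rw [Matrix.mem_unitaryGroup_iff', Matrix.star_eq_conjTranspose, ← Matrix.exp_conjTranspose,
    ← Matrix.star_eq_conjTranspose]
  have : star ((Complex.I * (θ : ℂ)) • pauliOp σ) = -((Complex.I * (θ : ℂ)) • pauliOp σ) := by
    rw [star_smul, h, ← neg_smul]; simp
  rw [this, exp_neg_mul_exp]

theorem IsSystemGate.mem_unitary {G : Op n} (hG : IsSystemGate G) :
    G ∈ Matrix.unitaryGroup (Basis n) ℂ := by
  obtain ⟨σ, ⟨z, hz, rfl⟩ | ⟨θ, rfl⟩⟩ := hG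
  · exact smul_pauliOp_mem_unitary hz σ
  · exact exp_I_smul_pauliOp_mem_unitary θ σ

theorem norm_of_mem_unitaryGroup {G : Op n} (hG : G ∈ Matrix.unitaryGroup (Basis n) ℂ) :
    ‖G‖ = 1 := CStarRing.norm_of_mem_unitary hG

/-! ### Stages of the Trotter formulas -/

theorem abs_mul_sign (r : ℝ) : |r| * Real.sign r = r := by
  rcases lt_trichotomy r 0 with h | rfl | h
  · rw [abs_of_neg h, Real.sign_of_neg h]; ring
  · simp
  · rw [abs_of_pos h, Real.sign_of_pos h]; ring

/-- Since `Real.sign 0 = 0`, a stage of length zero could spoil the unitarity of the terms and the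
positivity of their probabilities. -/
theorem suzukiStages_ne_zero (L k : ℕ) : ∀ p ∈ suzukiStages L k, p.2 ≠ 0 := by
  induction k with
  | zero => simp [suzukiStages]
  | succ k ih =>
    cases k with
    | zero =>
      intro p hp
      simp only [suzukiStages, List.mem_append, List.mem_map] at hp
      rcases hp with ⟨l, _, rfl⟩ | ⟨l, _, rfl⟩ <;> norm_num
    | succ k =>
      obtain ⟨h1, h2, -⟩ := suzukiU_two_le (k := k + 2) (by omega)
      intro p hp
      simp only [suzukiStages, scaleStages, List.mem_append, List.mem_map] at hp
      rcases hp with (((⟨q, hq, rfl⟩ | ⟨q, hq, rfl⟩) | ⟨q, hq, rfl⟩) | ⟨q, hq, rfl⟩) | ⟨q, hq, rfl⟩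
      · exact mul_ne_zero h1.ne' (ih q hq)
      · exact mul_ne_zero h1.ne' (ih q hq)
      · exact mul_ne_zero h2.ne (ih q hq)
      · exact mul_ne_zero h1.ne' (ih q hq)
      · exact mul_ne_zero h1.ne' (ih q hq)

theorem trotterStages_ne_zero (L K : ℕ) : ∀ p ∈ trotterStages L K, p.2 ≠ 0 := by
  intro p hp
  rw [trotterStages] at hp
  split_ifs at hp
  · obtain ⟨l, _, rfl⟩ := List.mem_map.1 hp
    norm_num
  · exact suzukiStages_ne_zero _ _ p hp

theorem suzukiStages_length (L k : ℕ) :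
    (suzukiStages L (k + 1)).length = 2 * 5 ^ k * L := by
  induction k with
  | zero => simp [suzukiStages]; ring
  | succ k ih =>
    rw [suzukiStages]
    simp only [scaleStages, List.length_append, List.length_map, ih]
    ring

theorem trotterStages_length {L K : ℕ} (hK : K = 1 ∨ Even K) :
    (trotterStages L K).length = kappa K * L := by
  by_cases h1 : K = 1
  · simp [trotterStages, kappa, h1]
  · obtain ⟨k, rfl⟩ := hK.resolve_left h1
    rw [trotterStages, if_neg h1, show (k + k) / 2 = k by omega, kappa]
    cases k with
    | zero => simp [suzukiStages]
    | succ k =>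
      rw [suzukiStages_length, if_neg (by omega), show (k + 1 + (k + 1)) / 2 - 1 = k by omega]

theorem suzukiStages_sum {L : ℕ} (c : Fin L → ℝ) (k : ℕ) :
    ((suzukiStages L k).map fun p => c p.1 * |p.2|).sum = suzukiLength k * ∑ l, c l := by
  have hsc : ∀ (u : ℝ) (st : List (Fin L × ℝ)),
      ((scaleStages u st).map fun p => c p.1 * |p.2|).sum =
        |u| * (st.map fun p => c p.1 * |p.2|).sum := by
    intro u st
    rw [← List.sum_map_mul_left, scaleStages, List.map_map]
    congr 1
    refine List.map_congr_left fun p _ => ?_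
    simp only [Function.comp_apply, abs_mul]; ring
  induction k with
  | zero => simp [suzukiStages, suzukiLength]
  | succ k ih =>
    cases k with
    | zero =>
      simp only [suzukiStages, suzukiLength, List.map_append, List.map_map, List.map_reverse,
        List.sum_append, List.sum_reverse, Function.comp_def, sum_finRange_map]
      rw [← Finset.sum_add_distrib, one_mul]
      refine Finset.sum_congr rfl fun l _ => ?_
      rw [abs_of_pos (by norm_num)]; ring
    | succ k =>
      simp only [suzukiStages, suzukiLength, List.map_append, List.sum_append, hsc, ih]
      ring

theorem trotterStages_sum {L : ℕ} (c : Fin L → ℝ) (K : ℕ) :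
    ((trotterStages L K).map fun p => c p.1 * |p.2|).sum = trotterLength K * ∑ l, c l := by
  rw [trotterStages, trotterLength]
  split_ifs
  · simp [List.map_reverse, Function.comp_def, sum_finRange_map]
  · exact suzukiStages_sum c _

theorem suzukiLength_nonneg (k : ℕ) : 0 ≤ suzukiLength k := by
  induction k with
  | zero => simp [suzukiLength]
  | succ k ih =>
    cases k with
    | zero => simp [suzukiLength]
    | succ k => rw [suzukiLength]; positivity

theorem trotterLength_nonneg (K : ℕ) : 0 ≤ trotterLength K := by
  rw [trotterLength]
  split_ifs
  · exact zero_le_one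
  · exact suzukiLength_nonneg _

namespace Hamiltonian

variable {n L : ℕ} (H : Hamiltonian n L)

theorem lam_pos (hL : 0 < L) : 0 < H.lam := by
  have : Nonempty (Fin L) := ⟨⟨0, hL⟩⟩
  exact Finset.sum_pos (fun l _ => H.coeff_pos l) Finset.univ_nonempty

theorem rate_pos (hL : 0 < L) (K : ℕ) : 0 < H.rate K :=
  mul_pos (by linarith [trotterLength_nonneg K]) (H.lam_pos hL)

/-! ### The Pauli operators of the Hamiltonian and of the terms -/

theorem exists_P_eq (l : Fin L) : ∃ ζ : ℝ, ζ ^ 2 = 1 ∧ H.P l = (ζ : ℂ) • pauliOp (H.str l) := by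
  rcases Int.units_eq_one_or (H.sgn l) with h | h
  · exact ⟨1, by norm_num, by simp [P, h]⟩
  · exact ⟨-1, by norm_num, by simp [P, h]⟩

theorem star_P (l : Fin L) : star (H.P l) = H.P l := by
  obtain ⟨ζ, _, h⟩ := H.exists_P_eq l
  rw [h, star_smul, Matrix.star_eq_conjTranspose, pauliOp_conjTranspose]
  simp

theorem isPhasedPauli_smul_P {z : ℂ} (hz : z ^ 4 = 1) (l : Fin L) :
    IsPhasedPauli (z • H.P l) := by
  obtain ⟨ζ, hζ, h⟩ := H.exists_P_eq l
  refine ⟨z * ζ, H.str l, ?_, by rw [h, smul_smul]⟩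
  have : ((ζ : ℂ)) ^ 4 = 1 := by
    rw [show (4 : ℕ) = 2 * 2 by rfl, pow_mul, ← Complex.ofReal_pow, hζ]; simp
  rw [mul_pow, hz, this, one_mul]

theorem isPhasedPauli_of_mem_termGates {K s : ℕ} (i : TermIdx L K s) :
    ∀ M ∈ H.termGates i, IsPhasedPauli M := by
  have hI' : (-Complex.I) ^ 4 = 1 := by rw [Even.neg_pow (by decide), Complex.I_pow_four]
  intro M hM
  simp only [termGates, List.mem_append, List.mem_ofFn, List.mem_flatten] at hM
  rcases hM with ⟨a, rfl⟩ | ⟨l, ⟨j, rfl⟩, hl⟩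
  · exact H.isPhasedPauli_smul_P hI' _
  · rw [List.eq_of_mem_replicate hl]
    refine H.isPhasedPauli_smul_P ?_ _
    have hne : ((remStages L K).get j).2 ≠ 0 :=
      trotterStages_ne_zero L K _ (List.mem_reverse.1 (List.get_mem _ j))
    rcases Real.sign_apply_eq_of_ne_zero _ hne with h | h
    · rw [h]; simpa using hI'
    · rw [h]; simp

theorem isPhasedPauli_termOp {K s : ℕ} (i : TermIdx L K s) : IsPhasedPauli (H.termOp i) :=
  isPhasedPauli_list_prod (H.isPhasedPauli_of_mem_termGates i)

theorem length_termGates {K s : ℕ} (i : TermIdx L K s) : (H.termGates i).length = s := by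
  have h := (Finset.mem_piAntidiag.1 i.1.2).1
  rw [Fintype.sum_option] at h
  simp [termGates, List.map_ofFn, Function.comp_def, List.sum_ofFn, h]

theorem exists_hermOp_eq {K s : ℕ} (i : TermIdx L K s) : ∃ (ζ : ℝ) (σ : Fin n → Pauli),
    ζ ^ 2 = 1 ∧ H.hermOp i = (ζ : ℂ) • pauliOp σ := by
  obtain ⟨ζ, σ, hζ, ⟨h1, h2⟩ | ⟨-, h1, h2⟩⟩ := (H.isPhasedPauli_termOp i).dichotomy
  · exact ⟨ζ, σ, hζ, by rw [hermOp, if_pos h1, h2]⟩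
  · exact ⟨ζ, σ, hζ, by rw [hermOp, if_neg h1, ← h2]⟩

/-- `i P' = P + (i - 1) (P + P†) / 2`, whether `P` is Hermitian or anti-Hermitian. -/
theorem I_smul_hermOp {K s : ℕ} (i : TermIdx L K s) : Complex.I • H.hermOp i =
    H.termOp i + ((Complex.I - 1) / 2) • (H.termOp i + star (H.termOp i)) := by
  rw [Matrix.star_eq_conjTranspose]
  obtain ⟨ζ, σ, hζ, ⟨h1, h2⟩ | ⟨h0, h1, h2⟩⟩ := (H.isPhasedPauli_termOp i).dichotomy
  · rw [hermOp, if_pos h1, smul_smul, h1]; simp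
  · rw [hermOp, if_neg h1, h0, ← two_smul ℂ, smul_smul, div_mul_cancel₀ _ two_ne_zero, sub_smul,
      one_smul]; abel

/-! ### Power series of the Trotter remainder -/

/-- `-i H_l`. -/
def gen (l : Fin L) : Op n := (-(Complex.I * (H.coeff l : ℂ))) • H.P l

theorem star_gen (l : Fin L) : star (H.gen l) = -H.gen l := by
  rw [gen, star_smul, star_P, ← neg_smul]; simp

theorem sum_gen : ∑ l, H.gen l = (-Complex.I) • H.op := by
  rw [op, Finset.smul_sum]
  exact Finset.sum_congr rfl fun l _ => by rw [gen, smul_smul, neg_mul]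

/-- The generators of the factors of `U(x) S_K(x)†`. -/
def remGens (K : ℕ) : List (Op n) :=
  (∑ l, H.gen l) :: (remStages L K).map fun p => -((p.2 : ℂ) • H.gen p.1)

/-- The power series of `U(x) S_K(x)†`. -/
def remSeries (K : ℕ) : PowerSeries (Op n) := prodExp (H.remGens K)

theorem remSeries_agreeBelow {K : ℕ} (hK : K = 1 ∨ Even K) :
    AgreeBelow (K + 1) (H.remSeries K) 1 := by
  rw [remSeries, remGens, prodExp_cons]
  exact remainder_order hK H.gen

theorem star_coeff_remSeries {K : ℕ} (hK : K = 1 ∨ Even K) {s : ℕ} (hs0 : 0 < s)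
    (hs : s ≤ 2 * K + 1) :
    star (PowerSeries.coeff s (H.remSeries K)) = -PowerSeries.coeff s (H.remSeries K) := by
  refine star_coeff_prodExp ?_ (H.remSeries_agreeBelow hK) hs0 (by omega)
  intro Z hZ
  rw [remGens, List.mem_cons, List.mem_map] at hZ
  rcases hZ with rfl | ⟨p, _, rfl⟩
  · rw [star_sum]; simp [star_gen]
  · rw [star_neg, star_smul, star_gen]; simp

/-- The Trotter remainder `U(x) S_K(x)†`. -/
def remainder (K : ℕ) (x : ℝ) : Op n :=
  ((H.remGens K).map fun Z => NormedSpace.exp ((x : ℂ) • Z)).prod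

theorem sumsTo_remSeries (K : ℕ) (x : ℝ) : SumsTo (H.remSeries K) x (H.remainder K x) :=
  sumsTo_prodExp _ _

theorem U_eq (x : ℝ) : H.U x = NormedSpace.exp ((x : ℂ) • ∑ l, H.gen l) := by
  rw [U, sum_gen, smul_smul]; congr 2; ring

theorem trotterGates_eq (K : ℕ) (x : ℝ) : H.trotterGates K x =
    ((trotterStages L K).map fun p => (x : ℂ) • ((p.2 : ℂ) • H.gen p.1)).map NormedSpace.exp := by
  rw [trotterGates, List.map_map]
  refine List.map_congr_left fun p _ => ?_
  rw [Function.comp_apply, gen, smul_smul, smul_smul]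
  congr 2; push_cast; ring

theorem remainder_mul_S (K : ℕ) (x : ℝ) : H.remainder K x * H.S K x = H.U x := by
  have h := prod_exp_neg_reverse_mul
    ((trotterStages L K).map fun p => (x : ℂ) • ((p.2 : ℂ) • H.gen p.1))
  rw [S, trotterGates_eq, remainder, remGens, List.map_cons, List.prod_cons, mul_assoc, U_eq]
  rw [← List.map_reverse, List.map_map] at h
  rw [List.map_map, remStages]
  simp only [Function.comp_def, smul_neg] at h ⊢
  rw [h, mul_one]

/-! ### Terms of the remainder -/

theorem termProb_pos (hL : 0 < L) {K s : ℕ} (i : TermIdx L K s) : 0 < H.termProb i := by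
  have hr := H.rate_pos hL K
  have hl := H.lam_pos hL
  refine mul_pos (mul_pos (mul_pos ?_ (pow_pos (div_pos hl hr) _)) ?_) ?_
  · exact_mod_cast Nat.multinomial_pos _ _
  · refine Finset.prod_pos fun j _ => pow_pos (div_pos (mul_pos (H.coeff_pos _) ?_) hr) _
    exact abs_pos.2 (trotterStages_ne_zero L K _ (List.mem_reverse.1 (List.get_mem _ j)))
  · exact Finset.prod_pos fun a _ => div_pos (H.coeff_pos _) hl

theorem sum_termIdx {M : Type*} [AddCommMonoid M] {K s : ℕ}
    (f : (m : Option (Fin (remStages L K).length) → ℕ) → (Fin (m none) → Fin L) → M) :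
    ∑ i : TermIdx L K s, f i.1.1 i.2 =
      ∑ m ∈ Finset.piAntidiag (Finset.univ : Finset (Option (Fin (remStages L K).length))) s,
        ∑ g, f m g := by
  rw [Fintype.sum_sigma, Finset.univ_eq_attach]
  exact Finset.sum_attach _ fun m => ∑ g, f m g

theorem sum_stage_weights (K : ℕ) :
    ∑ j, H.coeff ((remStages L K).get j).1 * |((remStages L K).get j).2| =
      trotterLength K * H.lam := by
  rw [lam, ← trotterStages_sum, ← List.sum_reverse, ← List.map_reverse]
  change _ = ((remStages L K).map _).sum
  conv_rhs => rw [← List.ofFn_get (remStages L K), List.map_ofFn, List.sum_ofFn]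
  rfl

theorem sum_termProb (hL : 0 < L) (K s : ℕ) : ∑ i : TermIdx L K s, H.termProb i = 1 := by
  have hr := H.rate_pos hL K
  have hl := H.lam_pos hL
  simp only [termProb]
  rw [sum_termIdx (fun m g => (Nat.multinomial Finset.univ m : ℝ) *
    (H.lam / H.rate K) ^ (m none) *
    (∏ j, (H.coeff ((remStages L K).get j).1 * |((remStages L K).get j).2| / H.rate K) ^
      (m (some j))) * ∏ a, H.coeff (g a) / H.lam)]
  have hg : ∀ r : ℕ, ∑ g : Fin r → Fin L, ∏ a, H.coeff (g a) / H.lam = 1 := by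
    intro r
    have := Finset.prod_univ_sum (fun _ : Fin r => (Finset.univ : Finset (Fin L)))
      fun _ l => H.coeff l / H.lam
    rw [Fintype.piFinset_univ] at this
    rw [← this, ← Finset.sum_div, ← lam, div_self hl.ne']
    simp
  simp only [← Finset.mul_sum, hg, mul_one]
  -- The shares of the factors of V in Λ_K. They sum to one, so the multinomial theorem gives total
  -- probability one.
  let w : Option (Fin (remStages L K).length) → ℝ := fun o => o.elim (H.lam / H.rate K) fun j =>
    H.coeff ((remStages L K).get j).1 * |((remStages L K).get j).2| / H.rate K
  have hw : ∑ o, w o = 1 := by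
    rw [Fintype.sum_option]
    simp only [w, Option.elim]
    rw [← Finset.sum_div, sum_stage_weights, ← add_div, div_eq_one_iff_eq hr.ne', rate]
    ring
  have := Finset.sum_pow_eq_sum_piAntidiag Finset.univ w s
  rw [hw, one_pow] at this
  rw [this]
  refine Finset.sum_congr rfl fun m _ => ?_
  rw [Fintype.prod_option]
  simp only [w, Option.elim]
  ring

/-- The coefficients of the Trotter remainder are mixtures of the operators of the terms. -/
theorem coeff_remSeries (hL : 0 < L) (K s : ℕ) : PowerSeries.coeff s (H.remSeries K) =
    ((H.rate K ^ s / (s.factorial : ℝ) : ℝ) : ℂ) •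
      ∑ i : TermIdx L K s, (H.termProb i : ℂ) • H.termOp i := by
  have hr := H.rate_pos hL K
  have hl := H.lam_pos hL
  have hofFn : (remStages L K).map (fun p => expPS (-((p.2 : ℂ) • H.gen p.1))) =
      List.ofFn fun j => expPS (-((((remStages L K).get j).2 : ℂ) •
        H.gen ((remStages L K).get j).1)) := by
    conv_lhs => rw [← List.ofFn_get (remStages L K), List.map_ofFn]
    rfl
  have hpow : ∀ r : ℕ, (∑ l, H.gen l) ^ r = ∑ g : Fin r → Fin L,
      ((∏ a, H.coeff (g a) : ℝ) : ℂ) • (List.ofFn fun a => (-Complex.I) • H.P (g a)).prod := by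
    intro r
    have := prod_ofFn_sum r fun _ l => H.gen l
    rw [List.ofFn_const, List.prod_replicate] at this
    rw [this]
    refine Finset.sum_congr rfl fun g _ => ?_
    rw [Complex.ofReal_prod, ← prod_ofFn_smul]
    simp only [gen, smul_smul]
    congr 2; funext a; congr 1; ring
  have hstage : ∀ (j : Fin (remStages L K).length) (m : ℕ),
      PowerSeries.coeff m (expPS (-((((remStages L K).get j).2 : ℂ) •
        H.gen ((remStages L K).get j).1))) =
      (((m.factorial : ℝ)⁻¹ *
        (H.coeff ((remStages L K).get j).1 * |((remStages L K).get j).2|) ^ m : ℝ) : ℂ) •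
        ((Complex.I * ((Real.sign ((remStages L K).get j).2 : ℝ) : ℂ)) •
        H.P ((remStages L K).get j).1) ^ m := by
    intro j m
    -- Split τ into modulus and sign: the modulus goes into the probability, the sign into the Pauli
    -- factor.
    have hs : -((((remStages L K).get j).2 : ℂ) • H.gen ((remStages L K).get j).1) =
        ((H.coeff ((remStages L K).get j).1 * |((remStages L K).get j).2| : ℝ) : ℂ) •
        ((Complex.I * ((Real.sign ((remStages L K).get j).2 : ℝ) : ℂ)) •
        H.P ((remStages L K).get j).1) := by
      rw [gen, smul_smul, smul_smul, ← neg_smul]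
      congr 1
      have hsg := congrArg (fun r : ℝ => (r : ℂ)) (abs_mul_sign ((remStages L K).get j).2)
      push_cast at hsg ⊢
      linear_combination (-(Complex.I * (H.coeff ((remStages L K).get j).1 : ℂ))) * hsg
    rw [coeff_expPS, hs, smul_pow, smul_smul]
    push_cast; rfl
  rw [remSeries, remGens, prodExp_cons, prodExp, List.map_map]
  simp only [Function.comp_def]
  rw [hofFn, coeff_mul_prod_ofFn]
  simp only [termProb, termOp, termGates]
  rw [sum_termIdx (fun m g => (((Nat.multinomial Finset.univ m : ℝ) *
    (H.lam / H.rate K) ^ (m none) *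
    (∏ j, (H.coeff ((remStages L K).get j).1 * |((remStages L K).get j).2| / H.rate K) ^
      (m (some j))) * ∏ a, H.coeff (g a) / H.lam : ℝ) : ℂ) •
    (List.ofFn (fun a => (-Complex.I) • H.P (g a)) ++
    (List.ofFn fun j => List.replicate (m (some j))
      ((Complex.I * ((Real.sign ((remStages L K).get j).2 : ℝ) : ℂ)) •
        H.P ((remStages L K).get j).1)).flatten).prod), Finset.smul_sum]
  refine Finset.sum_congr rfl fun m hm => ?_
  rw [coeff_expPS, hpow, Finset.smul_sum, Finset.sum_mul, Finset.smul_sum]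
  refine Finset.sum_congr rfl fun g _ => ?_
  simp only [hstage]
  rw [prod_ofFn_smul (remStages L K).length, smul_smul, smul_mul_smul_comm, smul_smul, List.prod_append,
    List.prod_flatten, List.map_ofFn]
  simp only [Function.comp_def, List.prod_replicate]
  congr 1
  have hsum := (Finset.mem_piAntidiag.1 hm).1
  -- Only a scalar identity is left. The inverse factorials equal the multinomial coefficient over
  -- s!, and the powers of Λ_K and λ cancel against the normalizations.
  have hmult := Nat.multinomial_spec Finset.univ m
  rw [hsum, Fintype.prod_option] at hmult
  rw [Fintype.sum_option] at hsum
  have hfac : ((m none).factorial : ℝ) ≠ 0 := by exact_mod_cast Nat.factorial_ne_zero _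
  have hfac' : (∏ j, ((m (some j)).factorial : ℝ)) ≠ 0 :=
    Finset.prod_ne_zero_iff.2 fun j _ => by exact_mod_cast Nat.factorial_ne_zero _
  have hmult' : (s.factorial : ℝ) = (m none).factorial * (∏ j, ((m (some j)).factorial : ℝ)) *
      (Nat.multinomial Finset.univ m : ℝ) := by rw [← hmult]; push_cast; rfl
  have hmn : (Nat.multinomial Finset.univ m : ℝ) ≠ 0 := by
    exact_mod_cast (Nat.multinomial_pos _ _).ne'
  rw [← Complex.ofReal_prod, ← Complex.ofReal_natCast, ← Complex.ofReal_inv, ← Complex.ofReal_mul,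
    ← Complex.ofReal_mul, ← Complex.ofReal_mul]
  congr 1
  simp only [div_pow, Finset.prod_mul_distrib, Finset.prod_div_distrib, Finset.prod_inv_distrib,
    Finset.prod_const, Finset.card_univ, Fintype.card_fin, Finset.prod_pow_eq_pow_sum]
  rw [hmult', ← hsum, pow_add]
  have h1 : H.rate K ≠ 0 := hr.ne'
  have h2 : H.lam ≠ 0 := hl.ne'
  field_simp

end Hamiltonian

/-! ### Exponential tails and perturbation of powers -/

/-- The remainder of order `m` of the exponential series. -/
def expTail (m : ℕ) (y : ℝ) : ℝ := ∑' k : ℕ, y ^ (k + m) / ((k + m).factorial : ℝ)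

/-- Telescoping. Powers of a are contractions, and each power of b costs at most M; as M ≥ 1, all ν
summands are bounded with the common factor M^ν. -/
theorem norm_pow_sub_pow_le {A : Type*} [NormedRing A] [NormOneClass A] {a b : A} {M : ℝ}
    (hM : 1 ≤ M) (ha : ‖a‖ ≤ 1) (hb : ‖b‖ ≤ M) (ν : ℕ) :
    ‖a ^ ν - b ^ ν‖ ≤ ν * M ^ ν * ‖a - b‖ := by
  induction ν with
  | zero => simp
  | succ ν ih =>
    have h : a ^ (ν + 1) - b ^ (ν + 1) = a ^ ν * (a - b) + (a ^ ν - b ^ ν) * b := by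
      rw [pow_succ, pow_succ]; noncomm_ring
    have ha' : ‖a ^ ν‖ ≤ 1 := (norm_pow_le a ν).trans (pow_le_one₀ (norm_nonneg _) ha)
    have h1 : 1 ≤ M ^ (ν + 1) := one_le_pow₀ hM
    calc ‖a ^ (ν + 1) - b ^ (ν + 1)‖ ≤ ‖a ^ ν‖ * ‖a - b‖ + ‖a ^ ν - b ^ ν‖ * ‖b‖ := by
          rw [h]; exact (norm_add_le _ _).trans (add_le_add (norm_mul_le _ _) (norm_mul_le _ _))
      _ ≤ M ^ (ν + 1) * ‖a - b‖ + (ν * M ^ ν * ‖a - b‖) * M := by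
          gcongr
          exact ha'.trans h1
      _ = ((ν + 1 : ℕ) : ℝ) * M ^ (ν + 1) * ‖a - b‖ := by push_cast; ring

namespace Hamiltonian

variable {n L : ℕ} (H : Hamiltonian n L)

/-! ### The paired formula of one segment -/

theorem eta_pos (hL : 0 < L) (K : ℕ) {x : ℝ} (hx : 0 < x) (s : ℕ) : 0 < H.eta K x s :=
  div_pos (pow_pos (mul_pos (H.rate_pos hL K) hx) _) (by exact_mod_cast Nat.factorial_pos s)

theorem etaSum_pos (hL : 0 < L) (K : ℕ) {x : ℝ} (hx : 0 < x) : 0 < H.etaSum K x :=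
  Finset.sum_pos (fun s _ => H.eta_pos hL K hx s) (Finset.nonempty_Icc.2 (by omega))

theorem segCoeff_pos (hL : 0 < L) {K sc : ℕ} {x : ℝ} (hx : 0 < x) (i : SegIdx L K sc) :
    0 < H.segCoeff K sc x i := by
  have h1 := H.eta_pos hL K hx i.1.1
  have h2 := H.etaSum_pos hL K hx
  have h3 := H.termProb_pos hL i.2
  rw [segCoeff]
  split_ifs <;> positivity

theorem isSystemGate_of_isPhasedPauli {M : Op n} (hM : IsPhasedPauli M) : IsSystemGate M := by
  obtain ⟨z, σ, hz, rfl⟩ := hM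
  exact ⟨σ, .inl ⟨z, norm_eq_one_of_pow_four hz, rfl⟩⟩

theorem isSystemGate_of_mem_segGates {K sc : ℕ} {x : ℝ} (i : SegIdx L K sc) :
    ∀ G ∈ H.segGates K sc x i, IsSystemGate G := by
  intro G hG
  rw [segGates] at hG
  split_ifs at hG
  · obtain ⟨ζ, σ, -, h⟩ := H.exists_hermOp_eq i.2
    rw [List.mem_singleton.1 hG, h, smul_smul]
    exact ⟨σ, .inr ⟨Real.arctan (H.etaSum K x) * ζ, by push_cast; rw [mul_assoc]⟩⟩
  · exact isSystemGate_of_isPhasedPauli (H.isPhasedPauli_of_mem_termGates i.2 G hG)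

theorem isSystemGate_of_mem_trotterGates {K : ℕ} {x : ℝ} :
    ∀ G ∈ H.trotterGates K x, IsSystemGate G := by
  intro G hG
  obtain ⟨p, _, rfl⟩ := List.mem_map.1 hG
  obtain ⟨ζ, -, h⟩ := H.exists_P_eq p.1
  refine ⟨H.str p.1, .inr ⟨-(x * p.2 * H.coeff p.1 * ζ), ?_⟩⟩
  rw [h, smul_smul]
  congr 2; push_cast; ring

theorem S_mem_unitary (K : ℕ) (x : ℝ) : H.S K x ∈ Matrix.unitaryGroup (Basis n) ℂ :=
  Submonoid.list_prod_mem _ fun G hG => (H.isSystemGate_of_mem_trotterGates G hG).mem_unitary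

theorem segOp_mem_unitary {K sc : ℕ} (x : ℝ) (i : SegIdx L K sc) :
    H.segOp K sc x i ∈ Matrix.unitaryGroup (Basis n) ℂ :=
  Submonoid.list_prod_mem _ fun G hG => (H.isSystemGate_of_mem_segGates i G hG).mem_unitary

theorem sum_segIdx {M : Type*} [AddCommMonoid M] {K sc : ℕ}
    (f : (s : ℕ) → TermIdx L K s → M) :
    ∑ i : SegIdx L K sc, f i.1.1 i.2 = ∑ s ∈ Finset.Icc (K + 1) sc, ∑ i, f s i := by
  rw [Fintype.sum_sigma, Finset.univ_eq_attach]
  exact Finset.sum_attach _ fun s => ∑ i, f s i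

theorem sum_Icc_split {M : Type*} [AddCommMonoid M] {K sc : ℕ} (hsc : 2 * K + 1 ≤ sc)
    (f : ℕ → M) : ∑ s ∈ Finset.Icc (K + 1) sc, f s =
      ∑ s ∈ Finset.Icc (K + 1) (2 * K + 1), f s + ∑ s ∈ Finset.Icc (2 * K + 2) sc, f s := by
  rw [← Finset.sum_union]
  · congr 1
    ext s
    simp only [Finset.mem_union, Finset.mem_Icc]; omega
  · rw [Finset.disjoint_left]
    intro s h1 h2
    simp only [Finset.mem_Icc] at h1 h2; omega

theorem sum_segCoeff (hL : 0 < L) {K sc : ℕ} (hsc : 2 * K + 1 ≤ sc) {x : ℝ} (hx : 0 < x) :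
    ∑ i, H.segCoeff K sc x i = H.segNorm K sc x := by
  have hsum0 := H.etaSum_pos hL K hx
  simp only [segCoeff]
  rw [sum_segIdx fun s (i : TermIdx L K s) => if s ≤ 2 * K + 1 then
    Real.sqrt (1 + H.etaSum K x ^ 2) * (H.eta K x s / H.etaSum K x) * H.termProb i
    else H.eta K x s * H.termProb i, sum_Icc_split hsc, segNorm]
  congr 1
  · rw [Finset.sum_congr rfl (g := fun s => Real.sqrt (1 + H.etaSum K x ^ 2) *
      (H.eta K x s / H.etaSum K x)), ← Finset.mul_sum, ← Finset.sum_div, ← etaSum,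
      div_self hsum0.ne', mul_one]
    intro s hs
    simp only [if_pos (Finset.mem_Icc.1 hs).2]
    rw [← Finset.mul_sum, sum_termProb H hL, mul_one]
  · refine Finset.sum_congr rfl fun s hs => ?_
    have : ¬ s ≤ 2 * K + 1 := by have := Finset.mem_Icc.1 hs; omega
    simp only [if_neg this]
    rw [← Finset.mul_sum, sum_termProb H hL, mul_one]

theorem eta_smul_sum_termOp (hL : 0 < L) (K s : ℕ) (x : ℝ) :
    (H.eta K x s : ℂ) • ∑ i : TermIdx L K s, (H.termProb i : ℂ) • H.termOp i =
      (x : ℂ) ^ s • PowerSeries.coeff s (H.remSeries K) := by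
  rw [coeff_remSeries H hL, smul_smul, eta]
  congr 1; push_cast; ring

/-- In the leading orders the Hermitian terms cancel. -/
theorem sum_hermOp (hL : 0 < L) {K : ℕ} (hK : K = 1 ∨ Even K) {s : ℕ} (hs0 : 0 < s)
    (hs : s ≤ 2 * K + 1) :
    ∑ i : TermIdx L K s, (H.termProb i : ℂ) • (Complex.I • H.hermOp i) =
      ∑ i : TermIdx L K s, (H.termProb i : ℂ) • H.termOp i := by
  have hskew := H.star_coeff_remSeries hK hs0 hs
  rw [coeff_remSeries H hL, star_smul, ← smul_neg] at hskew
  have hc : (((H.rate K ^ s / (s.factorial : ℝ) : ℝ)) : ℂ) ≠ 0 := by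
    have := H.rate_pos hL K
    have := Nat.factorial_pos s
    exact_mod_cast (by positivity : (0 : ℝ) < H.rate K ^ s / (s.factorial : ℝ)).ne'
  rw [Complex.star_def, Complex.conj_ofReal] at hskew
  have hskew' := smul_right_injective _ hc hskew
  -- The average of the terms is anti-Hermitian, so P + P† averages to zero. By `I_smul_hermOp` this
  -- is the whole difference of the two sides, up to the factor (i - 1)/2.
  have hz : ∑ i : TermIdx L K s, (H.termProb i : ℂ) • (H.termOp i + star (H.termOp i)) = 0 := by
    simp only [smul_add, Finset.sum_add_distrib]
    rw [star_sum] at hskew'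
    simp only [star_smul, Complex.star_def, Complex.conj_ofReal] at hskew'
    rw [hskew', add_neg_cancel]
  simp only [I_smul_hermOp, smul_add (H.termProb _ : ℂ) (H.termOp _), Finset.sum_add_distrib]
  simp only [smul_comm (H.termProb _ : ℂ) ((Complex.I - 1) / 2)]
  rw [← Finset.smul_sum, hz, smul_zero, add_zero]

/-- The paired formula is the Taylor polynomial of the Trotter remainder. -/
theorem sum_segOp (hL : 0 < L) {K : ℕ} (hK : K = 1 ∨ Even K) {sc : ℕ} (hsc : 2 * K + 1 ≤ sc)
    {x : ℝ} (hx : 0 < x) : ∑ i, (H.segCoeff K sc x i : ℂ) • H.segOp K sc x i =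
      1 + ∑ s ∈ Finset.Icc (K + 1) sc, (x : ℂ) ^ s • PowerSeries.coeff s (H.remSeries K) := by
  have hsum0 := H.etaSum_pos hL K hx
  have hterm : ∀ i : SegIdx L K sc, (H.segCoeff K sc x i : ℂ) • H.segOp K sc x i =
      if i.1.1 ≤ 2 * K + 1 then
        ((H.eta K x i.1.1 / H.etaSum K x * H.termProb i.2 : ℝ) : ℂ) • (1 : Op n) +
          (H.eta K x i.1.1 : ℂ) • ((H.termProb i.2 : ℂ) • (Complex.I • H.hermOp i.2))
      else (H.eta K x i.1.1 : ℂ) • ((H.termProb i.2 : ℂ) • H.termOp i.2) := by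
    intro i
    by_cases h : i.1.1 ≤ 2 * K + 1
    · obtain ⟨ζ, σ, hζ, hh⟩ := H.exists_hermOp_eq i.2
      have hinv : H.hermOp i.2 * H.hermOp i.2 = 1 := by
        rw [hh]; exact signed_pauliOp_mul_self hζ σ
      -- √(1+η²) cos(arctan η) = 1 and √(1+η²) sin(arctan η) = η. So iP' gets weight η_s Pr, and the
      -- identity gets η_s Pr/η_Σ, which adds up to 1 over the leading orders.
      rw [segCoeff, segOp, segGates, if_pos h, if_pos h, if_pos h, List.prod_singleton,
        exp_I_smul_of_involution hinv, Real.cos_arctan, Real.sin_arctan, smul_add, smul_smul,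
        smul_smul, smul_smul, smul_smul]
      have hsq : Real.sqrt (1 + H.etaSum K x ^ 2) ≠ 0 := (Real.sqrt_pos.2 (by positivity)).ne'
      congr 2
      · rw [← Complex.ofReal_mul]
        congr 1; field_simp
      · rw [mul_left_comm, ← Complex.ofReal_mul, ← Complex.ofReal_mul, mul_comm]
        congr 2; field_simp
    · rw [segCoeff, segOp, segGates, if_neg h, if_neg h, if_neg h, smul_smul, ← Complex.ofReal_mul]
      rfl
  rw [Finset.sum_congr rfl fun i _ => hterm i, sum_segIdx fun s (i : TermIdx L K s) =>
    if s ≤ 2 * K + 1 then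
        ((H.eta K x s / H.etaSum K x * H.termProb i : ℝ) : ℂ) • (1 : Op n) +
          (H.eta K x s : ℂ) • ((H.termProb i : ℂ) • (Complex.I • H.hermOp i))
      else (H.eta K x s : ℂ) • ((H.termProb i : ℂ) • H.termOp i), sum_Icc_split hsc,
    sum_Icc_split hsc, ← add_assoc]
  congr 1
  · rw [Finset.sum_congr rfl (g := fun s => ((H.eta K x s / H.etaSum K x : ℝ) : ℂ) • (1 : Op n) +
      (x : ℂ) ^ s • PowerSeries.coeff s (H.remSeries K)), Finset.sum_add_distrib,
      ← Finset.sum_smul, ← Complex.ofReal_sum, ← Finset.sum_div, ← etaSum, div_self hsum0.ne']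
    · simp
    · intro s hs
      have hs' := Finset.mem_Icc.1 hs
      simp only [if_pos hs'.2]
      rw [Finset.sum_add_distrib, ← Finset.smul_sum, sum_hermOp H hL hK (by omega) hs'.2,
        eta_smul_sum_termOp H hL, ← Finset.sum_smul, ← Complex.ofReal_sum, ← Finset.mul_sum,
        sum_termProb H hL, mul_one]
  · refine Finset.sum_congr rfl fun s hs => ?_
    have : ¬ s ≤ 2 * K + 1 := by have := Finset.mem_Icc.1 hs; omega
    simp only [if_neg this]
    rw [← Finset.smul_sum, eta_smul_sum_termOp H hL]

theorem norm_coeff_remSeries_le (hL : 0 < L) (K s : ℕ) {x : ℝ} (hx : 0 < x) :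
    ‖(x : ℂ) ^ s • PowerSeries.coeff s (H.remSeries K)‖ ≤ H.eta K x s := by
  rw [← eta_smul_sum_termOp H hL, norm_smul, Complex.norm_real, Real.norm_of_nonneg
    (H.eta_pos hL K hx s).le]
  refine mul_le_of_le_one_right (H.eta_pos hL K hx s).le ?_
  rw [← sum_termProb H hL K s]
  refine (norm_sum_le _ _).trans (Finset.sum_le_sum fun i _ => ?_)
  rw [norm_smul, norm_of_mem_unitaryGroup (H.isPhasedPauli_termOp i).mem_unitary, mul_one,
    Complex.norm_real, Real.norm_of_nonneg (H.termProb_pos hL i).le]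

/-- The paired sum is exactly the Taylor polynomial of degree s_c, so only the tail remains. Its
term of degree s is η_s times a mixture of unitaries. -/
theorem norm_remainder_sub_le (hL : 0 < L) {K : ℕ} (hK : K = 1 ∨ Even K) {sc : ℕ}
    (hsc : 2 * K + 1 ≤ sc) {x : ℝ} (hx : 0 < x) :
    ‖H.remainder K x - ∑ i, (H.segCoeff K sc x i : ℂ) • H.segOp K sc x i‖ ≤
      expTail (sc + 1) (H.rate K * x) := by
  obtain ⟨-, hsum⟩ := H.sumsTo_remSeries K x
  have hpoly : ∑ s ∈ Finset.range (sc + 1), (x : ℂ) ^ s • PowerSeries.coeff s (H.remSeries K) =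
      1 + ∑ s ∈ Finset.Icc (K + 1) sc, (x : ℂ) ^ s • PowerSeries.coeff s (H.remSeries K) := by
    have hagree := H.remSeries_agreeBelow hK
    rw [← Finset.sum_range_add_sum_Ico _ (show K + 1 ≤ sc + 1 by omega), Finset.sum_range_succ']
    congr 1
    · rw [Finset.sum_eq_zero, hagree 0 (by omega)]
      · simp
      · intro s hs
        rw [hagree (s + 1) (by have := Finset.mem_range.1 hs; omega)]
        simp [PowerSeries.coeff_one]
  rw [sum_segOp H hL hK hsc hx, ← hpoly, ← hsum.tsum_eq,
    ← hsum.summable.sum_add_tsum_nat_add (sc + 1), add_sub_cancel_left]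
  refine tsum_of_norm_bounded ?_ fun k => H.norm_coeff_remSeries_le hL K (k + (sc + 1)) hx
  exact ((summable_nat_add_iff (sc + 1)).2
    (Real.summable_pow_div_factorial (H.rate K * x))).hasSum

/-! ### The product of all segments -/

theorem sum_totCoeff (hL : 0 < L) {K sc ν : ℕ} (hsc : 2 * K + 1 ≤ sc) {t : ℝ} (ht : 0 < t / ν) :
    ∑ i, H.totCoeff K sc ν t i = H.segNorm K sc (t / ν) ^ ν := by
  have h := Finset.prod_univ_sum (fun _ : Fin ν => (Finset.univ : Finset (SegIdx L K sc)))
    fun _ i => H.segCoeff K sc (t / ν) i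
  rw [Fintype.piFinset_univ, sum_segCoeff H hL hsc ht] at h
  simp only [totCoeff]
  rw [← h]; simp

theorem sum_totOp {K sc ν : ℕ} {t : ℝ} :
    ∑ i, (H.totCoeff K sc ν t i : ℂ) • H.totOp K sc ν t i =
      ((∑ i, (H.segCoeff K sc (t / ν) i : ℂ) • H.segOp K sc (t / ν) i) * H.S K (t / ν)) ^ ν := by
  have h := prod_ofFn_sum ν fun _ i =>
    (H.segCoeff K sc (t / ν) i : ℂ) • (H.segOp K sc (t / ν) i * H.S K (t / ν))
  rw [List.ofFn_const, List.prod_replicate] at h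
  rw [Finset.sum_mul]
  simp only [smul_mul_assoc]
  rw [h]
  refine Finset.sum_congr rfl fun i _ => ?_
  rw [prod_ofFn_smul, totCoeff, Complex.ofReal_prod, totOp]

theorem U_pow {ν : ℕ} (hν : ν ≠ 0) (t : ℝ) : H.U (t / ν) ^ ν = H.U t := by
  let _ : NormedAlgebra ℚ (Op n) := NormedAlgebra.restrictScalars ℚ ℂ (Op n)
  have hν' : (ν : ℂ) ≠ 0 := by exact_mod_cast hν
  rw [U, U, ← NormedSpace.exp_nsmul, ← Nat.cast_smul_eq_nsmul ℂ, smul_smul]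
  congr 2; push_cast; field_simp

/-- The exact segment has norm 1 and the approximate one at most its 1-norm, which is at least 1.
Telescoping therefore multiplies the segment error by at most νμ. -/
theorem isLCU_tot (hL : 0 < L) {K : ℕ} (hK : K = 1 ∨ Even K) {sc ν : ℕ}
    (hsc : 2 * K + 1 ≤ sc) (hν : 0 < ν) {t μ ε : ℝ} (ht : 0 < t)
    (hμ : H.segNorm K sc (t / ν) ^ ν ≤ μ)
    (hε : ν * μ * expTail (sc + 1) (H.rate K * (t / ν)) ≤ ε) :
    IsLCU (H.totCoeff K sc ν t) (H.totOp K sc ν t) (H.segNorm K sc (t / ν) ^ ν) ε (H.U t) := by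
  have hx : 0 < t / ν := div_pos ht (by exact_mod_cast hν)
  refine ⟨fun i => Finset.prod_pos fun a _ => H.segCoeff_pos hL hx _, fun i => ?_,
    H.sum_totCoeff hL hsc hx, ?_⟩
  · refine Submonoid.list_prod_mem _ fun G hG => ?_
    obtain ⟨a, rfl⟩ := (List.mem_ofFn' _ _).1 hG
    exact mul_mem (H.segOp_mem_unitary _ _) (H.S_mem_unitary _ _)
  · set W := ∑ i, (H.segCoeff K sc (t / ν) i : ℂ) • H.segOp K sc (t / ν) i with hW
    set x := t / ν
    have hS := norm_of_mem_unitaryGroup (H.S_mem_unitary K x)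
    have hWn : ‖W * H.S K x‖ ≤ H.segNorm K sc x := by
      refine (norm_mul_le _ _).trans ?_
      rw [hS, mul_one, ← sum_segCoeff H hL hsc hx]
      refine (norm_sum_le _ _).trans (Finset.sum_le_sum fun i _ => ?_)
      rw [norm_smul, norm_of_mem_unitaryGroup (H.segOp_mem_unitary x i), mul_one,
        Complex.norm_real, Real.norm_of_nonneg (H.segCoeff_pos hL hx i).le]
    have hM : 1 ≤ H.segNorm K sc x := by
      have h1 : 1 ≤ Real.sqrt (1 + H.etaSum K x ^ 2) := 
        Real.one_le_sqrt.2 (le_add_of_nonneg_right (sq_nonneg _))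
      have h2 : 0 ≤ ∑ s ∈ Finset.Icc (2 * K + 2) sc, H.eta K x s :=
        Finset.sum_nonneg fun s _ => (H.eta_pos hL K hx s).le
      rw [segNorm]; linarith
    have hU : ‖H.U x‖ ≤ 1 := by
      have hmem : H.U x ∈ Matrix.unitaryGroup (Basis n) ℂ := by
        have hskew : star ((x : ℂ) • ∑ l, H.gen l) = -((x : ℂ) • ∑ l, H.gen l) := by
          rw [star_smul, star_sum]; simp [star_gen]
        rw [U_eq, Matrix.mem_unitaryGroup_iff', Matrix.star_eq_conjTranspose,
          ← Matrix.exp_conjTranspose, ← Matrix.star_eq_conjTranspose, hskew, exp_neg_mul_exp]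
      exact (norm_of_mem_unitaryGroup hmem).le
    have hdiff : ‖H.U x - W * H.S K x‖ ≤ expTail (sc + 1) (H.rate K * x) := by
      rw [← remainder_mul_S H K x, ← sub_mul]
      refine (norm_mul_le _ _).trans ?_
      rw [hS, mul_one]
      exact H.norm_remainder_sub_le hL hK hsc hx
    have hμ0 : 0 ≤ μ := (pow_nonneg (zero_le_one.trans hM) ν).trans hμ
    rw [sum_totOp, ← hW, ← U_pow H hν.ne']
    refine (norm_pow_sub_pow_le hM hU hWn ν).trans (le_trans ?_ hε)
    gcongr

end Hamiltonian

/-! ### The sampling circuit -/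

section Circuit

variable {n : ℕ}

theorem proj_mul_self (b : Fin 2) : proj b * proj b = proj b := by simp [proj]

theorem proj_zero_add_proj_one : proj 0 + proj 1 = 1 := by
  ext i j; fin_cases i <;> fin_cases j <;> simp [proj]

theorem proj_zero_mul_proj_one : proj 0 * proj 1 = 0 := by simp [proj]

theorem proj_one_mul_proj_zero : proj 1 * proj 0 = 0 := by simp [proj]

theorem ctrl_zero_eq (G : Op n) : ctrl 0 G = proj 0 ⊗ₖ G + proj 1 ⊗ₖ (1 : Op n) := by
  rw [ctrl, ← proj_zero_add_proj_one, add_sub_cancel_left]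

theorem ctrl_one_eq (G : Op n) : ctrl 1 G = proj 1 ⊗ₖ G + proj 0 ⊗ₖ (1 : Op n) := by
  rw [ctrl, ← proj_zero_add_proj_one, add_sub_cancel_right]

theorem onSystem_eq (G : Op n) : onSystem G = proj 0 ⊗ₖ G + proj 1 ⊗ₖ G := by
  rw [onSystem, ← Matrix.add_kronecker, proj_zero_add_proj_one]

/-- `|0⟩⟨0| ⊗ A + |1⟩⟨1| ⊗ B`. -/
def blockOp (A B : Op n) : OpA n := proj 0 ⊗ₖ A + proj 1 ⊗ₖ B

/-- Controlled and uncontrolled gates are all block diagonal in the ancilla, so the circuit can be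
evaluated separately in each block. -/
theorem blockOp_mul (A B A' B' : Op n) :
    blockOp A B * blockOp A' B' = blockOp (A * A') (B * B') := by
  simp only [blockOp, add_mul, mul_add, ← Matrix.mul_kronecker_mul, proj_mul_self,
    proj_zero_mul_proj_one, proj_one_mul_proj_zero, Matrix.zero_kronecker]
  abel

theorem blockOp_one : blockOp (1 : Op n) 1 = 1 := by
  rw [blockOp, ← Matrix.add_kronecker, proj_zero_add_proj_one, Matrix.one_kronecker_one]

theorem prod_map_blockOp {ι : Type*} (l : List ι) (A B : ι → Op n) :
    (l.map fun i => blockOp (A i) (B i)).prod = blockOp (l.map A).prod (l.map B).prod := by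
  induction l with
  | nil => simp [blockOp_one]
  | cons i l ih => simp [ih, blockOp_mul]

theorem prod_map_const_one (l : List (Op n)) : (l.map fun _ => (1 : Op n)).prod = 1 := by
  simp

theorem prod_map_ctrl_zero (l : List (Op n)) : (l.map (ctrl 0)).prod = blockOp l.prod 1 := by
  have h : ctrl 0 = fun G : Op n => blockOp G 1 := funext ctrl_zero_eq
  rw [h, prod_map_blockOp, List.map_id', prod_map_const_one]

theorem prod_map_ctrl_one (l : List (Op n)) : (l.map (ctrl 1)).prod = blockOp 1 l.prod := by
  have h : ctrl 1 = fun G : Op n => blockOp 1 G := funext fun G => by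
    rw [ctrl_one_eq, blockOp, add_comm]
  rw [h, prod_map_blockOp, List.map_id', prod_map_const_one]

theorem prod_map_onSystem (l : List (Op n)) :
    (l.map onSystem).prod = blockOp l.prod l.prod := by
  have h : onSystem = fun G : Op n => blockOp G G := funext onSystem_eq
  rw [h, prod_map_blockOp, List.map_id']

end Circuit

namespace Hamiltonian

variable {n L : ℕ} (H : Hamiltonian n L)

theorem isGate_of_mem_samplingCircuit {K sc ν : ℕ} {t : ℝ} (i j : Fin ν → SegIdx L K sc) :
    ∀ M ∈ H.samplingCircuit K sc ν t i j, IsGate M := by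
  intro M hM
  simp only [samplingCircuit, List.mem_flatten, List.mem_ofFn] at hM
  obtain ⟨l, ⟨a, rfl⟩, hl⟩ := hM
  simp only [List.mem_append, List.mem_map] at hl
  rcases hl with (⟨G, hG, rfl⟩ | ⟨G, hG, rfl⟩) | ⟨G, hG, rfl⟩
  · exact ⟨G, H.isSystemGate_of_mem_segGates _ G hG, .inr ⟨0, rfl⟩⟩
  · exact ⟨G, H.isSystemGate_of_mem_segGates _ G hG, .inr ⟨1, rfl⟩⟩
  · exact ⟨G, H.isSystemGate_of_mem_trotterGates G hG, .inl rfl⟩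

theorem prod_samplingCircuit {K sc ν : ℕ} {t : ℝ} (i j : Fin ν → SegIdx L K sc) :
    (H.samplingCircuit K sc ν t i j).prod = blockOp (H.totOp K sc ν t j) (H.totOp K sc ν t i) := by
  rw [samplingCircuit, List.prod_flatten, List.map_ofFn]
  have h : (List.prod ∘ fun a => (H.segGates K sc (t / ν) (j a)).map (ctrl 0) ++
      (H.segGates K sc (t / ν) (i a)).map (ctrl 1) ++
      (H.trotterGates K (t / ν)).map onSystem) = fun a =>
      blockOp (H.segOp K sc (t / ν) (j a) * H.S K (t / ν))
        (H.segOp K sc (t / ν) (i a) * H.S K (t / ν)) := by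
    funext a
    rw [Function.comp_apply, List.prod_append, List.prod_append, prod_map_ctrl_zero,
      prod_map_ctrl_one, prod_map_onSystem, blockOp_mul, blockOp_mul, one_mul, mul_one]
    rfl
  rw [h, totOp, totOp, List.ofFn_eq_map, prod_map_blockOp, List.ofFn_eq_map, List.ofFn_eq_map]

theorem length_segGates_le {K sc : ℕ} (hsc : 1 ≤ sc) {x : ℝ} (i : SegIdx L K sc) :
    (H.segGates K sc x i).length ≤ sc := by
  rw [segGates]
  split_ifs
  · simpa using hsc
  · rw [length_termGates]; exact (Finset.mem_Icc.1 i.1.2).2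

theorem length_samplingCircuit_le {K sc ν : ℕ} (hK : K = 1 ∨ Even K) (hsc : 1 ≤ sc) {t : ℝ}
    (i j : Fin ν → SegIdx L K sc) :
    (H.samplingCircuit K sc ν t i j).length ≤ ν * (2 * sc + kappa K * L) := by
  rw [samplingCircuit, List.length_flatten, List.map_ofFn, List.sum_ofFn]
  refine (Finset.sum_le_card_nsmul _ _ (2 * sc + kappa K * L) fun a _ => ?_).trans (by simp)
  have h1 := H.length_segGates_le hsc (x := t / ν) (i a)
  have h2 := H.length_segGates_le hsc (x := t / ν) (j a)
  have h3 : (H.trotterGates K (t / ν)).length = kappa K * L := by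
    rw [trotterGates, List.length_map, trotterStages_length hK]
  simp only [Function.comp_apply, List.length_append, List.length_map]
  omega

end Hamiltonian

/-! ### Remainders of the exponential series -/

theorem summable_expTail (m : ℕ) (y : ℝ) :
    Summable fun k : ℕ => y ^ (k + m) / ((k + m).factorial : ℝ) :=
  (summable_nat_add_iff m).2 (Real.summable_pow_div_factorial y)

theorem sum_range_add_expTail (m : ℕ) (y : ℝ) :
    ∑ s ∈ Finset.range m, y ^ s / (s.factorial : ℝ) + expTail m y = Real.exp y := by
  rw [Real.exp_eq_exp_ℝ, NormedSpace.exp_eq_tsum_div]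
  exact (Real.summable_pow_div_factorial y).sum_add_tsum_nat_add m

theorem expTail_nonneg (m : ℕ) {y : ℝ} (hy : 0 ≤ y) : 0 ≤ expTail m y :=
  tsum_nonneg fun _ => by positivity

theorem expTail_le_exp (m : ℕ) {y : ℝ} (hy : 0 ≤ y) : expTail m y ≤ Real.exp y := by
  rw [← sum_range_add_expTail m y]
  have : 0 ≤ ∑ s ∈ Finset.range m, y ^ s / (s.factorial : ℝ) :=
    Finset.sum_nonneg fun _ _ => by positivity
  linarith

/-- Every term has degree at least m, so shrinking the argument by c ≤ 1 gains at least c^m. -/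
theorem expTail_mul_le (m : ℕ) {c z : ℝ} (hc0 : 0 ≤ c) (hc1 : c ≤ 1) (hz : 0 ≤ z) :
    expTail m (c * z) ≤ c ^ m * expTail m z := by
  rw [expTail, expTail, ← tsum_mul_left]
  refine Summable.tsum_le_tsum (fun k => ?_) (summable_expTail m _)
    ((summable_expTail m z).mul_left _)
  rw [mul_pow, mul_div_assoc]
  have : c ^ (k + m) ≤ c ^ m := pow_le_pow_of_le_one hc0 hc1 (by omega)
  gcongr

/-- The extreme case is m = 2, where the tail is e - 2 < 3/4. -/
theorem expTail_one_le {m : ℕ} (hm : 2 ≤ m) : expTail m 1 ≤ 3 / 4 := by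
  have h := sum_range_add_expTail m 1
  have h2 : ∑ s ∈ Finset.range 2, (1 : ℝ) ^ s / (s.factorial : ℝ) ≤
      ∑ s ∈ Finset.range m, (1 : ℝ) ^ s / (s.factorial : ℝ) :=
    Finset.sum_le_sum_of_subset_of_nonneg (Finset.range_mono hm) fun _ _ _ => by positivity
  have h3 : ∑ s ∈ Finset.range 2, (1 : ℝ) ^ s / (s.factorial : ℝ) = 2 := by
    norm_num [Finset.sum_range_succ]
  have := Real.exp_one_lt_d9
  linarith

theorem expTail_le_pow {m : ℕ} (hm : 2 ≤ m) {y : ℝ} (hy0 : 0 ≤ y) (hy1 : y ≤ 1) :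
    expTail m y ≤ 3 / 4 * y ^ m := by
  have h := expTail_mul_le m hy0 hy1 zero_le_one
  rw [mul_one] at h
  have := expTail_one_le hm
  have : 0 ≤ y ^ m := by positivity
  nlinarith

/-- Scale down from the argument m with c = y/m; the tail at m is at most e^m. -/
theorem expTail_le_of_le {m : ℕ} {y : ℝ} (hy : 0 ≤ y) (hm : 0 < m) (hym : y ≤ m) :
    expTail m y ≤ (Real.exp 1 * y / m) ^ m := by
  have hm' : (0 : ℝ) < m := by exact_mod_cast hm
  have h := expTail_mul_le m (div_nonneg hy hm'.le) ((div_le_one hm').2 hym) hm'.le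
  rw [div_mul_cancel₀ _ hm'.ne'] at h
  refine h.trans ?_
  rw [mul_div_assoc, mul_pow, mul_comm, ← Real.exp_nat_mul, mul_one]
  gcongr
  exact expTail_le_exp m hm'.le

/-- A tail of positive order shrinks at least linearly with its argument, so more segments do not
increase the total error bound. This lets the real number ν_K(t) replace the integer ν. -/
theorem mul_expTail_div_le {m : ℕ} (hm : 0 < m) {a ν₀ ν : ℝ} (ha : 0 ≤ a) (hν₀ : 0 < ν₀)
    (h : ν₀ ≤ ν) : ν * expTail m (a / ν) ≤ ν₀ * expTail m (a / ν₀) := by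
  have hν : 0 < ν := hν₀.trans_le h
  have hc1 : ν₀ / ν ≤ 1 := (div_le_one hν).2 h
  have hc0 : 0 ≤ ν₀ / ν := by positivity
  have h1 := expTail_mul_le m hc0 hc1 (div_nonneg ha hν₀.le)
  rw [show ν₀ / ν * (a / ν₀) = a / ν by field_simp] at h1
  have h2 : (ν₀ / ν) ^ m ≤ ν₀ / ν := pow_le_of_le_one hc0 hc1 hm.ne'
  have h3 := expTail_nonneg m (div_nonneg ha hν₀.le)
  calc ν * expTail m (a / ν) ≤ ν * (ν₀ / ν * expTail m (a / ν₀)) := by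
        gcongr
        exact h1.trans (by gcongr)
    _ = ν₀ * expTail m (a / ν₀) := by field_simp

theorem sum_Icc_le_expTail (m b : ℕ) {y : ℝ} (hy : 0 ≤ y) :
    ∑ s ∈ Finset.Icc m b, y ^ s / (s.factorial : ℝ) ≤ expTail m y := by
  rw [← Finset.Ico_succ_right_eq_Icc, Finset.sum_Ico_eq_sum_range]
  simp only [add_comm m]
  exact (summable_expTail m y).sum_le_tsum _ fun _ _ => by positivity

/-- For y ≤ 1 the terms from degree 2 on are at most y², and 1 + y² ≤ exp(y²); for y ≥ 1 simply y ≤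
y². It serves K = 0, where y is not bounded by 1. -/
theorem exp_le_add_exp_sq {y : ℝ} (hy : 0 ≤ y) : Real.exp y ≤ y + Real.exp (y ^ 2) := by
  rcases le_total y 1 with h | h
  · have h1 := sum_range_add_expTail 2 y
    have h2 := expTail_le_pow le_rfl hy h
    have h3 : ∑ s ∈ Finset.range 2, y ^ s / (s.factorial : ℝ) = 1 + y := by
      norm_num [Finset.sum_range_succ]
    have h4 := Real.add_one_le_exp (y ^ 2)
    nlinarith [sq_nonneg y]
  · have : Real.exp y ≤ Real.exp (y ^ 2) := Real.exp_le_exp.2 (by nlinarith)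
    linarith

theorem sqrt_one_add_sq_le (a : ℝ) : Real.sqrt (1 + a ^ 2) ≤ 1 + a ^ 2 / 2 := by
  rw [Real.sqrt_le_left (by positivity)]
  nlinarith [sq_nonneg (a ^ 2)]

/-! ### The Lambert function -/

/-- `invFunOn` satisfies the equation once a preimage exists, and the intermediate value theorem on
[0, y] gives one. Positivity follows since w exp(w) has the sign of w. -/
theorem lambertW_spec {y : ℝ} (hy : 0 < y) :
    0 < lambertW y ∧ lambertW y * Real.exp (lambertW y) = y := by
  have hex : ∃ w ∈ Set.Ici (-1 : ℝ), w * Real.exp w = y := by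
    have hc : ContinuousOn (fun w : ℝ => w * Real.exp w) (Set.Icc 0 y) := by fun_prop
    have h1 : y ≤ y * Real.exp y :=
      le_mul_of_one_le_right hy.le (Real.one_le_exp hy.le)
    obtain ⟨w, hw, hwy⟩ := intermediate_value_Icc hy.le hc ⟨by simpa using hy.le, h1⟩
    exact ⟨w, by have := hw.1; simp only [Set.mem_Ici]; linarith, hwy⟩
  have hspec : lambertW y * Real.exp (lambertW y) = y := Function.invFunOn_eq hex
  refine ⟨?_, hspec⟩
  by_contra h
  have := mul_nonpos_of_nonpos_of_nonneg (not_lt.1 h) (Real.exp_pos (lambertW y)).le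
  linarith

/-- For w = W₀(M/(ey)) one has e y e^w = M/w ≤ m. Hence the bound (ey/m)^m is at most e^(-wm) ≤
e^(-M). -/
theorem expTail_le_exp_neg {M y : ℝ} (hM : 0 < M) (hy : 0 < y) {m : ℕ} (hm : 0 < m)
    (h : M / lambertW (M / (Real.exp 1 * y)) ≤ m) : expTail m y ≤ Real.exp (-M) := by
  obtain ⟨hw, hwe⟩ := lambertW_spec (y := M / (Real.exp 1 * y)) (by positivity)
  set w := lambertW (M / (Real.exp 1 * y))
  have hm' : (0 : ℝ) < m := by exact_mod_cast hm
  have h0 : Real.exp 1 * y * Real.exp w = M / w := by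
    have := Real.exp_pos 1
    field_simp at hwe ⊢
    linarith
  have h1 : Real.exp 1 * y * Real.exp w ≤ m := h0 ▸ h
  have hy1 : y ≤ m := by
    have h2 := Real.one_le_exp (zero_le_one (α := ℝ))
    have h3 := Real.one_le_exp hw.le
    have h4 : 1 ≤ Real.exp 1 * Real.exp w := one_le_mul_of_one_le_of_one_le h2 h3
    nlinarith
  refine (expTail_le_of_le hy.le hm hy1).trans ?_
  have h2 : Real.exp 1 * y / m ≤ Real.exp (-w) := by
    rw [Real.exp_neg, div_le_iff₀ hm', ← div_eq_inv_mul, le_div_iff₀ (Real.exp_pos w)]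
    exact h1
  calc (Real.exp 1 * y / m) ^ m ≤ Real.exp (-w) ^ m := by gcongr
    _ = Real.exp (-(w * m)) := by rw [← Real.exp_nat_mul]; congr 1; ring
    _ ≤ Real.exp (-M) := by
        rw [div_le_iff₀ hw] at h
        exact Real.exp_le_exp.2 (by linarith)

/-- If Rw < M, the hypothesis gives w < log(Rz), and then R w e^w < MRz contradicts w e^w = Mz. Only
the defining equation of W₀ is needed, not its monotonicity. -/
theorem div_lambertW_le {M z R : ℝ} (hM : 0 < M) (hz : 0 < z) (hR : 0 < R)
    (h : M ≤ R * Real.log (R * z)) : M / lambertW (M * z) ≤ R := by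
  obtain ⟨hw, hwe⟩ := lambertW_spec (y := M * z) (by positivity)
  set w := lambertW (M * z)
  rw [div_le_iff₀ hw]
  by_contra hlt
  rw [not_le] at hlt
  have h1 : w < Real.log (R * z) := lt_of_mul_lt_mul_left (hlt.trans_le h) hR.le
  have h2 : Real.exp w < R * z := by
    rw [← Real.exp_log (show 0 < R * z by positivity)]; exact Real.exp_lt_exp.2 h1
  have h3 : R * (w * Real.exp w) < M * (R * z) := by
    calc R * (w * Real.exp w) = (R * w) * Real.exp w := by ring
      _ < M * (R * z) := mul_lt_mul'' hlt h2 (by positivity) (Real.exp_pos _).le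
  rw [hwe] at h3
  linarith

theorem one_le_pairConst (K : ℕ) : 1 ≤ pairConst K := by
  have h := Real.one_le_exp (zero_le_one (α := ℝ))
  rw [pairConst]
  split_ifs
  · norm_num
  · linarith
  · have : 0 ≤ 1 / 2 * (Real.exp 1 / ((K : ℝ) + 1)) ^ (2 * K + 2) := by positivity
    linarith

namespace Hamiltonian

variable {n L : ℕ} (H : Hamiltonian n L)

/-! ### The 1-norm -/

/-- The square root exceeds 1 by O(y^(2K+2)), and the tail has that order too. For K = 0 the sum is
at most exp(y²) + y²/2 ≤ exp(3y²/2), for every y. For K ≥ 1 and y ≤ 1 it is at most 1 + (5/4)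
y^(2K+2), and `pairConst` enters only through being at least e. -/
theorem segNorm_le (hL : 0 < L) {K sc : ℕ} {x : ℝ} (hx : 0 < x)
    (h1 : K ≠ 0 → H.rate K * x ≤ 1) :
    H.segNorm K sc x ≤ Real.exp (pairConst K * (H.rate K * x) ^ (2 * K + 2)) := by
  have hy : 0 < H.rate K * x := mul_pos (H.rate_pos hL K) hx
  have hsm0 := (H.etaSum_pos hL K hx).le
  have hsqrt := sqrt_one_add_sq_le (H.etaSum K x)
  have htail : ∑ s ∈ Finset.Icc (2 * K + 2) sc, H.eta K x s ≤ expTail (2 * K + 2) (H.rate K * x) :=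
    sum_Icc_le_expTail _ _ hy.le
  set y := H.rate K * x with hydef
  by_cases hK : K = 0
  · subst hK
    have hsm : H.etaSum 0 x = y := by simp [etaSum, eta, hydef]
    have h2 := sum_range_add_expTail 2 y
    have h3 : ∑ s ∈ Finset.range 2, y ^ s / (s.factorial : ℝ) = 1 + y := by
      norm_num [Finset.sum_range_succ]
    have h4 := exp_le_add_exp_sq hy.le
    have h5 : Real.exp (pairConst 0 * y ^ (2 * 0 + 2)) =
        Real.exp (y ^ 2) * Real.exp (y ^ 2 / 2) := by
      rw [← Real.exp_add]; congr 1; simp [pairConst]; ring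
    have h6 := Real.add_one_le_exp (y ^ 2 / 2)
    have h7 := Real.one_le_exp (sq_nonneg y)
    rw [hsm] at hsqrt
    rw [segNorm, hsm, h5]
    simp only [mul_zero, zero_add] at htail ⊢
    have h8 : Real.exp (y ^ 2) * (y ^ 2 / 2 + 1) ≤ Real.exp (y ^ 2) * Real.exp (y ^ 2 / 2) := by
      gcongr
    nlinarith [sq_nonneg y]
  · have hy1 := h1 hK
    have hsm1 : H.etaSum K x ≤ 3 / 4 * y ^ (K + 1) :=
      (sum_Icc_le_expTail (K + 1) (2 * K + 1) hy.le).trans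
        (expTail_le_pow (by omega) hy.le hy1)
    have ht := htail.trans (expTail_le_pow (by omega) hy.le hy1)
    have hsq : H.etaSum K x ^ 2 ≤ y ^ (2 * K + 2) := by
      have hp : 0 ≤ y ^ (K + 1) := by positivity
      rw [show 2 * K + 2 = (K + 1) * 2 by ring, pow_mul]
      gcongr
      linarith
    have hp : 0 ≤ y ^ (2 * K + 2) := by positivity
    have hC : Real.exp 1 ≤ pairConst K := by
      rw [pairConst, if_neg hK]
      split_ifs
      · linarith
      · have : 0 ≤ 1 / 2 * (Real.exp 1 / ((K : ℝ) + 1)) ^ (2 * K + 2) := by positivity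
        linarith
    have he := Real.exp_one_gt_d9
    have h6 := Real.add_one_le_exp (pairConst K * y ^ (2 * K + 2))
    rw [segNorm]
    nlinarith

theorem nuP_pos (hL : 0 < L) (K : ℕ) {t μ : ℝ} (ht : 0 < t) (hμ : 1 < μ) : 0 < H.nuP K t μ := by
  have ha : 0 < H.rate K * t := mul_pos (H.rate_pos hL K) ht
  have hl := Real.log_pos hμ
  have hC : 0 < pairConst K := by linarith [one_le_pairConst K]
  rw [nuP]; positivity

/-- The defining equation of ν_K(t) without the root, the form used for the 1-norm and for small
times. -/
theorem nuP_pow (hL : 0 < L) (K : ℕ) {t μ : ℝ} (ht : 0 < t) (hμ : 1 < μ) :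
    Real.log μ * H.nuP K t μ ^ (2 * K + 1) = pairConst K * (H.rate K * t) ^ (2 * K + 2) := by
  have ha : 0 < H.rate K * t := mul_pos (H.rate_pos hL K) ht
  have hl := Real.log_pos hμ
  have hC : 0 < pairConst K := by linarith [one_le_pairConst K]
  rw [nuP, mul_pow, ← Real.rpow_natCast, ← Real.rpow_mul (by positivity)]
  have : 1 / (2 * (K : ℝ) + 1) * ((2 * K + 1 : ℕ) : ℝ) = 1 := by
    push_cast; field_simp
  rw [this, Real.rpow_one]
  field_simp
  ring

theorem nuP_le_nuMin (K : ℕ) (t μ : ℝ) : H.nuP K t μ ≤ H.nuMin K t μ := by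
  rw [nuMin]
  split_ifs
  · exact le_rfl
  · exact le_max_left _ _

/-- The exponents of the segments add up to C(Λt)^(2K+2)/ν^(2K+1), which is at most ln μ for ν ≥
ν_K(t). For K ≥ 1 the threshold ν ≥ Λt gives y ≤ 1. -/
theorem segNorm_pow_le (hL : 0 < L) {K sc ν : ℕ} {t μ : ℝ} (ht : 0 < t) (hμ : 1 < μ)
    (hν0 : 0 < ν) (hν : H.nuMin K t μ ≤ ν) : H.segNorm K sc (t / ν) ^ ν ≤ μ := by
  have hν' : (0 : ℝ) < ν := by exact_mod_cast hν0
  have hx : 0 < t / ν := div_pos ht hν'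
  have hy : 0 < H.rate K * (t / ν) := mul_pos (H.rate_pos hL K) hx
  have h1 : K ≠ 0 → H.rate K * (t / ν) ≤ 1 := by
    intro hK
    rw [nuMin, if_neg hK] at hν
    rw [← mul_div_assoc, div_le_one hν']
    exact (le_max_right _ _).trans hν
  have hpos : 0 ≤ H.segNorm K sc (t / ν) := by
    rw [segNorm]
    exact add_nonneg (Real.sqrt_nonneg _) (Finset.sum_nonneg fun s _ => (H.eta_pos hL K hx s).le)
  calc H.segNorm K sc (t / ν) ^ ν
      ≤ Real.exp (pairConst K * (H.rate K * (t / ν)) ^ (2 * K + 2)) ^ ν := by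
        gcongr
        exact H.segNorm_le hL hx h1
    _ = Real.exp (ν * (pairConst K * (H.rate K * (t / ν)) ^ (2 * K + 2))) := by
        rw [← Real.exp_nat_mul]
    _ ≤ Real.exp (Real.log μ) := by
        refine Real.exp_le_exp.2 ?_
        have hb : H.nuP K t μ ^ (2 * K + 1) ≤ (ν : ℝ) ^ (2 * K + 1) := by
          have := (H.nuP_pos hL K ht hμ).le
          gcongr
          exact (H.nuP_le_nuMin K t μ).trans hν
        have h2 := mul_le_mul_of_nonneg_left hb (Real.log_pos hμ).le
        rw [nuP_pow H hL K ht hμ] at h2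
        rw [← mul_div_assoc, div_pow, show 2 * K + 2 = (2 * K + 1) + 1 by ring, pow_succ (ν : ℝ)]
        rw [show (ν : ℝ) * (pairConst K * ((H.rate K * t) ^ (2 * K + 1 + 1) /
          ((ν : ℝ) ^ (2 * K + 1) * ν))) = pairConst K * (H.rate K * t) ^ (2 * K + 2) /
          (ν : ℝ) ^ (2 * K + 1) by field_simp]
        rw [div_le_iff₀ (by positivity)]
        exact h2
    _ = μ := Real.exp_log (by linarith)

/-! ### The truncation error -/

/-- Here the logarithm in the truncation threshold is not positive, and the Lambert bound says
nothing. But ν_K(t) ≤ ε/μ forces Λt ≤ 1, and the tail from degree 3 (K = 0) or 2K+2 (K ≥ 1) is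
already small enough. -/
theorem truncation_error_le_of_small (hL : 0 < L) {K sc ν : ℕ} {t μ ε : ℝ} (ht : 0 < t)
    (hμ : 1 < μ) (hε0 : 0 < ε) (hε1 : ε < 1) (hν : 0 < ν) (hsc : 2 ≤ sc)
    (hscK : 2 * K + 1 ≤ sc) (hb : H.nuP K t μ ≤ ε / μ) :
    ν * μ * expTail (sc + 1) (H.rate K * (t / ν)) ≤ ε := by
  have hν1 : (1 : ℝ) ≤ ν := by exact_mod_cast hν
  have ha : 0 < H.rate K * t := mul_pos (H.rate_pos hL K) ht
  have hpow := H.nuP_pow hL K ht hμ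
  have hb0 := H.nuP_pos hL K ht hμ
  have hlog := Real.log_pos hμ
  have hμ0 : 0 < μ := by linarith
  have hlogμ : Real.log μ ≤ μ := (Real.log_le_sub_one_of_pos hμ0).trans (by linarith)
  have hC := one_le_pairConst K
  have h1 := mul_expTail_div_le (show 0 < sc + 1 by omega) ha.le zero_lt_one hν1
  rw [one_mul, div_one] at h1
  rw [← mul_div_assoc, mul_right_comm]
  set a := H.rate K * t
  set b := H.nuP K t μ
  have hbμ : b * μ ≤ ε := (le_div_iff₀ hμ0).1 hb
  have hb1 : b ≤ 1 := hb.trans ((div_le_one hμ0).2 (by linarith))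
  have hlb : Real.log μ * b ≤ ε := le_trans (by nlinarith) hbμ
  have ha1 : a ≤ 1 := by
    by_contra hgt
    have h2 : 1 < a ^ (2 * K + 2) := one_lt_pow₀ (not_le.1 hgt) (by omega)
    have h3 : b ^ (2 * K + 1) ≤ b := pow_le_of_le_one hb0.le hb1 (by omega)
    nlinarith
  have htail := expTail_le_pow (m := sc + 1) (by omega) ha.le ha1
  suffices hs : a ^ (sc + 1) * (3 / 4) * μ ≤ ε by
    calc ν * expTail (sc + 1) (a / ν) * μ ≤ (3 / 4 * a ^ (sc + 1)) * μ :=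
          mul_le_mul_of_nonneg_right (h1.trans htail) hμ0.le
      _ ≤ ε := by linarith
  by_cases hK : K = 0
  · subst hK
    have h2 : a ^ (sc + 1) ≤ a ^ 3 := pow_le_pow_of_le_one ha.le ha1 (by omega)
    simp only [pairConst, if_true, mul_zero, zero_add, pow_one] at hpow
    -- From x³/3! ≤ e^x at x = log μ. It bounds log μ · a by 2 uniformly in μ, so a³μ ≤ (4/3) ε, and
    -- the tail factor 3/4 cancels the 4/3.
    have hcube : Real.log μ ^ 3 ≤ 6 * μ := by
      have := Real.pow_div_factorial_le_exp (Real.log μ) hlog.le 3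
      rw [Real.exp_log hμ0] at this
      norm_num [Nat.factorial] at this
      linarith
    have h3 : Real.log μ * a ≤ 2 := by
      refine abs_le_of_sq_le_sq' ?_ (by norm_num) |>.2
      have h4 : μ * (Real.log μ * a) ^ 2 ≤ μ * 4 := by
        have h5 : (Real.log μ * a) ^ 2 = 2 / 3 * (Real.log μ ^ 3 * b) := by
          have : a ^ 2 = 2 / 3 * (Real.log μ * b) := by linarith
          rw [mul_pow, this]; ring
        have h6 : Real.log μ ^ 3 * b ≤ 6 * μ * b := by gcongr
        rw [h5]
        nlinarith
      have := le_of_mul_le_mul_left h4 hμ0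
      linarith
    have h7 : a ^ 3 * μ ≤ 4 / 3 * ε := by
      calc a ^ 3 * μ = 2 / 3 * (Real.log μ * a) * (b * μ) := by
            have : a ^ 2 = 2 / 3 * (Real.log μ * b) := by linarith
            rw [pow_succ, this]; ring
        _ ≤ 2 / 3 * 2 * ε := by gcongr
        _ = 4 / 3 * ε := by ring
    have h8 : a ^ (sc + 1) * μ ≤ a ^ 3 * μ := by gcongr
    linarith
  · have h2 : a ^ (sc + 1) ≤ a ^ (2 * K + 2) := pow_le_pow_of_le_one ha.le ha1 (by omega)
    have h3 : b ^ (2 * K + 1) ≤ b ^ 2 := pow_le_pow_of_le_one hb0.le hb1 (by omega)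
    have hp : 0 ≤ a ^ (2 * K + 2) := by positivity
    have h4 : a ^ (2 * K + 2) ≤ Real.log μ * b ^ 2 := by nlinarith
    calc a ^ (sc + 1) * (3 / 4) * μ ≤ a ^ (2 * K + 2) * 1 * μ := by gcongr; norm_num
      _ ≤ Real.log μ * b ^ 2 * 1 * μ := by gcongr
      _ = (Real.log μ * b) * (b * μ) := by ring
      _ ≤ 1 * ε := by
          refine mul_le_mul (hlb.trans hε1.le) hbμ (by positivity) zero_le_one
      _ = ε := one_mul _

theorem truncation_error_le (hL : 0 < L) {K sc ν : ℕ} {t μ ε : ℝ} (ht : 0 < t)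
    (hμ : 1 < μ) (hε0 : 0 < ε) (hε1 : ε < 1) (hν0 : 0 < ν) (hν : H.nuMin K t μ ≤ ν)
    (hsc : H.scMin K t μ ε ≤ sc) :
    ν * μ * expTail (sc + 1) (H.rate K * (t / ν)) ≤ ε := by
  have ha : 0 < H.rate K * t := mul_pos (H.rate_pos hL K) ht
  have hb0 := H.nuP_pos hL K ht hμ
  have hμ0 : 0 < μ := by linarith
  rw [scMin, max_le_iff, max_le_iff] at hsc
  obtain ⟨hsc1, hsc2, hsc3⟩ := hsc
  rcases le_or_gt (Real.log (μ / ε * H.nuP K t μ)) 0 with hM | hM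
  · refine H.truncation_error_le_of_small hL ht hμ hε0 hε1 hν0 hsc2 hsc3 ?_
    have h := (Real.log_nonpos_iff (by positivity)).1 hM
    rw [le_div_iff₀ hμ0]
    rw [div_mul_eq_mul_div, div_le_one hε0] at h
    linarith
  -- The tail starts at s_c + 1, which absorbs the -1 in the threshold.
  · have hceil := (Nat.le_ceil _).trans (Nat.cast_le (α := ℝ).2 hsc1)
    set M := Real.log (μ / ε * H.nuP K t μ)
    have hexp : Real.exp (-M) = ε / (μ * H.nuP K t μ) := by
      rw [Real.exp_neg, Real.exp_log (by positivity)]; field_simp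
    have harg : 1 / (Real.exp 1 * (H.rate K * t)) * H.nuP K t μ * M =
        M / (Real.exp 1 * (H.rate K * t / H.nuP K t μ)) := by
      have := Real.exp_pos 1
      field_simp
    rw [harg] at hceil
    have h1 := expTail_le_exp_neg hM (y := H.rate K * t / H.nuP K t μ) (by positivity)
      (m := sc + 1) (by omega) (by push_cast; linarith)
    have h2 := mul_expTail_div_le (show 0 < sc + 1 by omega) ha.le hb0
      ((H.nuP_le_nuMin K t μ).trans hν)
    rw [← mul_div_assoc, mul_right_comm]
    calc ν * expTail (sc + 1) (H.rate K * t / ν) * μ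
        ≤ (H.nuP K t μ * Real.exp (-M)) * μ :=
          mul_le_mul_of_nonneg_right (h2.trans (mul_le_mul_of_nonneg_left h1 hb0.le)) hμ0.le
      _ = ε := by rw [hexp]; field_simp

/-! ### The number of gates -/

/-- Makes log((μ/ε) ν_K(t)) positive in the regime of the gate count, so that the Lambert quotient
can be estimated there. -/
theorem one_le_mul_nuP (hL : 0 < L) (K : ℕ) {t μ : ℝ} (ht : 0 < t) (hμ : 1 < μ)
    (ha : 1 ≤ H.rate K * t) : 1 ≤ μ * H.nuP K t μ := by
  have hlog := Real.log_pos hμ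
  have hμ0 : 0 < μ := by linarith
  have hb0 := H.nuP_pos hL K ht hμ
  have hlogμ : Real.log μ ≤ μ := (Real.log_le_sub_one_of_pos hμ0).trans (by linarith)
  have h1 : 1 ≤ Real.log μ * H.nuP K t μ ^ (2 * K + 1) := by
    rw [nuP_pow H hL K ht hμ]
    exact one_le_mul_of_one_le_of_one_le (one_le_pairConst K) (one_le_pow₀ ha)
  by_contra hlt
  have h2 : (μ * H.nuP K t μ) ^ (2 * K + 1) < 1 :=
    pow_lt_one₀ (by positivity) (not_le.1 hlt) (by omega)
  rw [mul_pow] at h2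
  have h3 : μ ≤ μ ^ (2 * K + 1) := le_self_pow₀ hμ.le (by omega)
  have h4 : Real.log μ * H.nuP K t μ ^ (2 * K + 1) ≤ μ ^ (2 * K + 1) * H.nuP K t μ ^ (2 * K + 1) := by
    gcongr
    exact hlogμ.trans h3
  linarith

end Hamiltonian

/-! ### Asymptotics of the thresholds -/

theorem log_log_bounds {l : ℝ} (hl : 1 < l) :
    1 ≤ l / Real.log l ∧ Real.log l / 2 ≤ Real.log (l / Real.log l) := by
  have hlog := Real.log_pos hl
  refine ⟨(one_le_div hlog).2 ((Real.log_le_sub_one_of_pos (by linarith)).trans (by linarith)), ?_⟩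
  rw [Real.log_div (by linarith) hlog.ne']
  -- At half of log l this gives log log l ≤ (log l)/2 - 1 + log 2 < (log l)/2.
  have h1 := Real.log_le_sub_one_of_pos (half_pos hlog)
  rw [Real.log_div hlog.ne' (by norm_num)] at h1
  have := Real.log_two_lt_d9
  linarith

/-- The Lambert-type threshold is `O(log(1/ε) / log log(1/ε))`, uniformly in `B ≥ b₀`. -/
theorem lambert_threshold_le {q b₀ : ℝ} (hq : 0 ≤ q) (hb₀ : 0 < b₀) (c : ℝ) :
    ∃ D : ℝ, 0 < D ∧ ∀ B l M : ℝ, b₀ ≤ B → 1 < l → 0 < M → M ≤ l + c + q * Real.log B →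
      M / lambertW (M * (B / Real.exp 1)) ≤ D * (l / Real.log l) := by
  set c₁ := c + q * Real.log b₀ with hc₁
  -- The summand q makes D l/log l ≥ q, e/b₀ makes D b₀/e ≥ 1, and 2 + 2|c₁| gives l + c₁ ≤ (D/2) l.
  refine ⟨q + Real.exp 1 / b₀ + 2 + 2 * |c₁|, by positivity, fun B l M hB hl hM hMl => ?_⟩
  set D := q + Real.exp 1 / b₀ + 2 + 2 * |c₁| with hD
  obtain ⟨hg1, hg2⟩ := log_log_bounds hl
  have hlog := Real.log_pos hl
  have hD0 : 0 < D := by positivity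
  have hB0 : 0 < B := hb₀.trans_le hB
  have hg0 : 0 < l / Real.log l := by linarith
  refine div_lambertW_le hM (by positivity) (by positivity) ?_
  have hDb : 1 ≤ D * b₀ / Real.exp 1 := by
    rw [le_div_iff₀ (Real.exp_pos 1), one_mul, ← div_le_iff₀ hb₀]
    have := abs_nonneg c₁
    linarith
  -- The part log(B/b₀) pays for the q log B in M, and log(l/log l) ≥ (log l)/2 pays for l. Hence D
  -- is uniform in B.
  have hsplit : Real.log (D * (l / Real.log l) * (B / Real.exp 1)) =
      Real.log (D * b₀ / Real.exp 1) + Real.log (B / b₀) + Real.log (l / Real.log l) := by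
    rw [← Real.log_mul (by positivity) (by positivity), ← Real.log_mul (by positivity)
      (by positivity)]
    congr 1
    have := Real.exp_pos 1
    field_simp
  have hA := Real.log_nonneg hDb
  have hBl : 0 ≤ Real.log (B / b₀) := Real.log_nonneg ((one_le_div hb₀).2 hB)
  have hR : q ≤ D * (l / Real.log l) := by
    have : q ≤ D := by
      have := abs_nonneg c₁
      have : 0 < Real.exp 1 / b₀ := by positivity
      linarith
    nlinarith
  have hBeq : Real.log (B / b₀) = Real.log B - Real.log b₀ :=
    Real.log_div hB0.ne' hb₀.ne'
  have h1 : D / 2 * l = D * (l / Real.log l) * (Real.log l / 2) := by field_simp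
  have h2 : D * (l / Real.log l) * (Real.log l / 2 + Real.log (B / b₀)) ≤
      D * (l / Real.log l) * Real.log (D * (l / Real.log l) * (B / Real.exp 1)) := by
    rw [hsplit]
    exact mul_le_mul_of_nonneg_left (by linarith) (by positivity)
  have h3 : q * Real.log (B / b₀) ≤ D * (l / Real.log l) * Real.log (B / b₀) := by gcongr
  have h4 : l + c₁ ≤ D / 2 * l := by
    have h5 : 1 + |c₁| ≤ D / 2 := by
      have : 0 < Real.exp 1 / b₀ := by positivity
      linarith
    have h6 := le_abs_self c₁
    have h7 := abs_nonneg c₁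
    nlinarith
  rw [mul_add, ← h1] at h2
  rw [hBeq] at h3 h2
  linarith

/-- With B = ν_K(t)/(Λt) one has Λt = B^(2K+1) ln μ / C, so log ν_K(t) is (2K+2) log B plus a
constant. The Lambert argument also contains B, which makes the bound independent of t. -/
theorem exists_scMin_le (K : ℕ) {μ : ℝ} (hμ : 1 < μ) : ∃ D : ℝ, 0 < D ∧
    ∀ (n L : ℕ) (H : Hamiltonian n L) (t ε : ℝ), 0 < L → 0 < t → 1 ≤ H.rate K * t → 0 < ε →
      ε < Real.exp (-1) →
      (H.scMin K t μ ε : ℝ) ≤ D * (Real.log (1 / ε) / Real.log (Real.log (1 / ε))) := by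
  have hlog := Real.log_pos hμ
  have hC : 0 < pairConst K := by linarith [one_le_pairConst K]
  have hμ0 : 0 < μ := by linarith
  set p : ℝ := 1 / (2 * (K : ℝ) + 1) with hp
  have hp0 : 0 < p := by positivity
  obtain ⟨D, hD0, hD⟩ := lambert_threshold_le (q := 2 * (K : ℝ) + 2)
    (b₀ := (pairConst K * 1 / Real.log μ) ^ p) (by positivity) (by positivity)
    (Real.log μ + Real.log (Real.log μ / pairConst K))
  refine ⟨D + (2 * K + 2), by positivity, fun n L H t ε hL ht ha hε0 hε => ?_⟩
  have hl : 1 < Real.log (1 / ε) := by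
    rw [one_div, Real.log_inv]
    have := Real.log_lt_log hε0 hε
    rw [Real.log_exp] at this
    linarith
  have hε1 : ε < 1 := hε.trans (by rw [Real.exp_lt_one_iff]; norm_num)
  set l := Real.log (1 / ε) with hldef
  obtain ⟨hg1, -⟩ := log_log_bounds hl
  set B := (pairConst K * (H.rate K * t) / Real.log μ) ^ p with hB
  have ha0 : 0 < H.rate K * t := by linarith
  have hB0 : 0 < B := by positivity
  have hnu : H.nuP K t μ = B * (H.rate K * t) := rfl
  have hnu0 := H.nuP_pos hL K ht hμ
  have hMeq : Real.log (μ / ε * H.nuP K t μ) =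
      l + (Real.log μ + Real.log (Real.log μ / pairConst K)) +
        (2 * (K : ℝ) + 2) * Real.log B := by
    have hlB : Real.log B = p * Real.log (pairConst K * (H.rate K * t) / Real.log μ) :=
      Real.log_rpow (by positivity) _
    have hlB' : (2 * (K : ℝ) + 1) * Real.log B =
        Real.log (pairConst K * (H.rate K * t) / Real.log μ) := by
      rw [hlB, hp]; field_simp
    rw [Real.log_div (by positivity) hlog.ne', Real.log_mul hC.ne' ha0.ne'] at hlB'
    rw [hnu, Real.log_mul (by positivity) (by positivity), Real.log_div hμ0.ne' hε0.ne',
      Real.log_mul hB0.ne' ha0.ne', Real.log_div hlog.ne' hC.ne', hldef, one_div, Real.log_inv]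
    linarith
  have hM : 0 < Real.log (μ / ε * H.nuP K t μ) := by
    refine Real.log_pos ?_
    have h1 := H.one_le_mul_nuP hL K ht hμ ha
    rw [div_mul_eq_mul_div, one_lt_div hε0]
    linarith
  have harg : 1 / (Real.exp 1 * (H.rate K * t)) * H.nuP K t μ *
      Real.log (μ / ε * H.nuP K t μ) =
      Real.log (μ / ε * H.nuP K t μ) * (B / Real.exp 1) := by
    have := Real.exp_pos 1
    have := H.rate_pos hL K
    generalize Real.log (μ / ε * H.nuP K t μ) = M
    rw [hnu]
    field_simp
  have hkey := hD B l _ (Real.rpow_le_rpow (by positivity) (by gcongr) hp0.le) hl hM hMeq.le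
  rw [Hamiltonian.scMin, harg]
  set X := Real.log (μ / ε * H.nuP K t μ) /
    lambertW (Real.log (μ / ε * H.nuP K t μ) * (B / Real.exp 1))
  set g := l / Real.log l
  have hX0 : 0 ≤ X := div_nonneg hM.le (lambertW_spec (by positivity)).1.le
  -- The natural ceiling is zero when X ≤ 1, so the two cases are treated apart.
  have hceil : (⌈X - 1⌉₊ : ℝ) ≤ X := by
    rcases le_total X 1 with h | h
    · rw [Nat.ceil_eq_zero.2 (by linarith)]; simpa using hX0
    · have := Nat.ceil_lt_add_one (show 0 ≤ X - 1 by linarith)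
      linarith
  have hrhs : (2 * (K : ℝ) + 2) ≤ (2 * K + 2) * g := le_mul_of_one_le_right (by positivity) hg1
  have hDg : 0 ≤ D * g := by positivity
  push_cast
  rw [add_mul]
  refine max_le (by nlinarith) (max_le ?_ ?_) <;> nlinarith

/-- Λ_K is λ times a constant depending on K. For λt ≥ 1 the threshold Λt and the 1 lost to the
ceiling are both dominated by the main power of λt. -/
theorem exists_nuMin_le (K : ℕ) {μ : ℝ} (hμ : 1 < μ) : ∃ E : ℝ, 0 < E ∧
    ∀ (n L : ℕ) (H : Hamiltonian n L) (t : ℝ), 1 ≤ H.lam * t → 0 ≤ H.nuMin K t μ →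
      (⌈H.nuMin K t μ⌉₊ : ℝ) ≤ E * (H.lam * t) ^ (1 + 1 / (2 * (K : ℝ) + 1)) := by
  have hlog := Real.log_pos hμ
  have hC : 0 < pairConst K := by linarith [one_le_pairConst K]
  have hρ := trotterLength_nonneg K
  set p : ℝ := 1 / (2 * (K : ℝ) + 1) with hp
  have hp0 : 0 < p := by positivity
  set r := 1 + trotterLength K with hr
  have hr0 : 0 < r := by positivity
  refine ⟨(pairConst K * r / Real.log μ) ^ p * r + r + 1, by positivity,
    fun n L H t hlt h0 => ?_⟩
  set T := H.lam * t
  have hT : 0 < T := by linarith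
  have hrate : H.rate K * t = r * T := by simp only [Hamiltonian.rate, T, hr]; ring
  have hQ : T ^ (1 + p) = T ^ p * T := by rw [Real.rpow_add hT, Real.rpow_one, mul_comm]
  have hTp : 1 ≤ T ^ p := Real.one_le_rpow hlt hp0.le
  have hTQ : T ≤ T ^ (1 + p) := by rw [hQ]; exact le_mul_of_one_le_left hT.le hTp
  have hnu : H.nuP K t μ = (pairConst K * r / Real.log μ) ^ p * r * T ^ (1 + p) := by
    rw [Hamiltonian.nuP, hrate, hQ, ← hp,
      show pairConst K * (r * T) / Real.log μ = pairConst K * r / Real.log μ * T by ring,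
      Real.mul_rpow (by positivity) hT.le]
    ring
  have hmin : H.nuMin K t μ ≤ (pairConst K * r / Real.log μ) ^ p * r * T ^ (1 + p) +
      r * T ^ (1 + p) := by
    have h1 : 0 ≤ (pairConst K * r / Real.log μ) ^ p * r * T ^ (1 + p) := by positivity
    have h2 : 0 ≤ r * T ^ (1 + p) := by positivity
    have h3 : r * T ≤ r * T ^ (1 + p) := by gcongr
    rw [Hamiltonian.nuMin, hnu, hrate]
    split_ifs
    · linarith
    · exact max_le (by linarith) (by linarith)
  have hceil := Nat.ceil_lt_add_one h0
  rw [add_mul, add_mul, one_mul]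
  linarith

end PTS

end

/-! ### Assembly of the two statements -/

theorem mainTheorem1 (K : ℕ) (hK : K = 1 ∨ Even K) :
    (∀ (n L : ℕ) (H : PTS.Hamiltonian n L) (t μ ε : ℝ), 0 < L → 0 < t → 1 < μ → 0 < ε → ε < 1 →
      ∀ ν sc : ℕ, H.nuMin K t μ ≤ (ν : ℝ) → H.scMin K t μ ε ≤ sc →
        PTS.IsLCU (H.totCoeff K sc ν t) (H.totOp K sc ν t) (H.segNorm K sc (t / ν) ^ ν) ε (H.U t) ∧
        H.segNorm K sc (t / ν) ^ ν ≤ μ ∧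
        ∀ i j : Fin ν → PTS.SegIdx L K sc,
          (∀ M ∈ H.samplingCircuit K sc ν t i j, PTS.IsGate M) ∧
          (H.samplingCircuit K sc ν t i j).prod =
            Matrix.kronecker (PTS.proj 0) (H.totOp K sc ν t j) +
              Matrix.kronecker (PTS.proj 1) (H.totOp K sc ν t i)) ∧
    (∀ μ : ℝ, 1 < μ → ∃ C : ℝ, 0 < C ∧
      ∀ (n L : ℕ) (H : PTS.Hamiltonian n L) (t ε : ℝ), 0 < L → 0 < t → 1 ≤ H.lam * t →
        0 < ε → ε < Real.exp (-1) →
        ∀ i j : Fin ⌈H.nuMin K t μ⌉₊ → PTS.SegIdx L K (H.scMin K t μ ε),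
          ((H.samplingCircuit K (H.scMin K t μ ε) ⌈H.nuMin K t μ⌉₊ t i j).length : ℝ) ≤
            C * ((H.lam * t) ^ (1 + 1 / (2 * (K : ℝ) + 1)) *
              ((PTS.kappa K : ℝ) * L + Real.log (1 / ε) / Real.log (Real.log (1 / ε))))) := by
  refine ⟨fun n L H t μ ε hL ht hμ hε0 hε1 ν sc hν hsc => ?_, fun μ hμ => ?_⟩
  · have hnu := (H.nuP_pos hL K ht hμ).trans_le ((H.nuP_le_nuMin K t μ).trans hν)
    have hν0 : 0 < ν := by exact_mod_cast hnu
    have hsc' : 2 * K + 1 ≤ sc :=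
      ((le_max_right _ _).trans (le_max_right _ _)).trans hsc
    have hnorm := H.segNorm_pow_le hL (sc := sc) ht hμ hν0 hν
    exact ⟨H.isLCU_tot hL hK hsc' hν0 ht hnorm
      (H.truncation_error_le hL ht hμ hε0 hε1 hν0 hν hsc), hnorm,
      fun i j => ⟨H.isGate_of_mem_samplingCircuit i j, H.prod_samplingCircuit i j⟩⟩
  · obtain ⟨D, hD0, hD⟩ := PTS.exists_scMin_le K hμ
    obtain ⟨E, hE0, hE⟩ := PTS.exists_nuMin_le K hμ
    -- E comes from the number of segments. Two compensations of at most s_c gates each give 2D, and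
    -- the Trotter gates give the 1.
    refine ⟨E * (2 * D + 1), by positivity, fun n L H t ε hL ht hlt hε0 hε i j => ?_⟩
    have hρ := PTS.trotterLength_nonneg K
    have ha : 1 ≤ H.rate K * t := by
      rw [PTS.Hamiltonian.rate, mul_assoc]
      nlinarith
    have hsc := hD n L H t ε hL ht ha hε0 hε
    have hν := hE n L H t hlt ((H.nuP_pos hL K ht hμ).le.trans (H.nuP_le_nuMin K t μ))
    have hlen := H.length_samplingCircuit_le hK
      (show 1 ≤ H.scMin K t μ ε from
        le_trans (by norm_num) ((le_max_left 2 _).trans (le_max_right _ _))) (t := t) i j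
    have hlen' : ((H.samplingCircuit K (H.scMin K t μ ε) ⌈H.nuMin K t μ⌉₊ t i j).length : ℝ) ≤
        (⌈H.nuMin K t μ⌉₊ : ℝ) * (2 * (H.scMin K t μ ε : ℝ) + PTS.kappa K * L) := by
      exact_mod_cast hlen
    set Q := (H.lam * t) ^ (1 + 1 / (2 * (K : ℝ) + 1))
    set g := Real.log (1 / ε) / Real.log (Real.log (1 / ε))
    have hg : 0 ≤ D * g := (Nat.cast_nonneg _).trans hsc
    have hg0 : 0 ≤ g := nonneg_of_mul_nonneg_right hg hD0
    have hQ0 : 0 ≤ E * Q := (Nat.cast_nonneg _).trans hν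
    have hκ : (0 : ℝ) ≤ PTS.kappa K * L := by positivity
    calc _ ≤ _ := hlen'
      _ ≤ (E * Q) * (2 * (D * g) + PTS.kappa K * L) := by gcongr
      _ ≤ (E * Q) * ((2 * D + 1) * (PTS.kappa K * L + g)) := by
          gcongr
          nlinarith
      _ = _ := by ring
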